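/- Let $D\subset\mathbb{R}^2$ be the open unit disk, $T>0$, and $\mathbf u_0\in C^2(\bar D;\mathbb{R}^3)$ with $|\mathbf u_0|=1$. Let $\mathbf u:[0,T]\times\bar D\to\mathbb{R}^3$ be a smooth solution of the harmonic map heat flow $$\partial_t\mathbf u=\Delta\mathbf u+|\nabla\mathbf u|^2\mathbf u \ \text{ in } (0,T]\times D,\qquad \mathbf u(0,\cdot)=\mathbf u_0 \text{ in } D,\qquad \mathbf u(t,\cdot)=\mathbf u_0 \text{ on } \partial D \text{ for } t\in[0,T],$$ where smooth means $\mathbf u\in C^1([0,T]\times\bar D)$ and $\mathbf u(t,\cdot)\in C^2(D)$ for $t\in(0,T]$. *Finite element spaces.* Let $p\in\{1,2\}$. Let $\mathcal T_h$ be a conforming triangulation that fills a polygon inscribed in $\partial D$, with all its boundary vertices on $\partial D$; let $h$ be the largest diameter of a triangle. The elements are either the straight triangles or, if $p=2$, quadratic isoparametric elements: the element map $F_K$ from the reference triangle $\hat K$ is the quadratic Lagrange interpolant determined by the vertices and edge midpoints of $K$, where the midpoints of boundary edges are moved radially onto $\partial D$ (the elements lie in $\bar D$, are not folded and do not overlap).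 Let $D_h$ be the union of the elements $F_K(\hat K)$, and let $(\cdot,\cdot)$ and $\|\cdot\|_{L^2}$ be the $L^2$ scalar product and norm on $D_h$. Put $$V_h^p=\{v\in C(D_h): v\circ F_K\in\mathcal P_p \text{ on } \hat K \text{ for all } K\in\mathcal T_h\},\quad V_{h,0}^p=\{v\in V_h^p: v=0 \text{ on } \partial D_h\},\quad \mathbf V_{h}^p=[V_h^p]^3,\quad \mathbf V_{h,0}^p=[V_{h,0}^p]^3,$$ and $\mathbf b(\mathbf a;\mathbf v,w)=(\mathbf a\cdot\mathbf v,w)$. *Tangential finite element method (TFEM).* Let $k\in\{1,2\}$, $J\ge1$, $\tau=T/J$, $t_j=j\tau$. The coefficients of BDF1 and BDF2 are $(\delta^{(1)}_0,\delta^{(1)}_1)=(1,-1)$ and $(\delta^{(2)}_0,\delta^{(2)}_1,\delta^{(2)}_2)=(\tfrac32,-2,\tfrac12)$. For $0\le j\le J-1$ let $\kappa=\kappa_j=\min\{k,j+1\}$ be the order of the step from $t_j$ to $t_{j+1}$ (the first step of BDF2 is a BDF1 step), and let $$\hat{\mathbf u}_h^{j+1}=\hat{\mathbf u}_h^{j+1,(\kappa)},\qquad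 \hat{\mathbf u}_h^{j+1,(1)}=\frac{\mathbf u_h^{j}}{|\mathbf u_h^{j}|},\qquad \hat{\mathbf u}_h^{j+1,(2)}=\frac{2\mathbf u_h^{j}-\mathbf u_h^{j-1}}{|2\mathbf u_h^{j}-\mathbf u_h^{j-1}|}.$$ The iterates are $\mathbf u_h^0=\mathcal I_h\mathbf u_0\in\mathbf V_h^p$ (nodal interpolation) and $$\mathbf u_h^{j+1}=\frac{\tau}{\delta_0^{(\kappa)}}\dot{\mathbf u}_h^{j+1}-\sum_{i=1}^{\kappa}\frac{\delta_i^{(\kappa)}}{\delta_0^{(\kappa)}}\mathbf u_h^{j+1-i},\qquad 0\le j\le J-1,$$ where $\dot{\mathbf u}_h^{j+1}\in\mathbf T_h^j:=\{\mathbf v\in\mathbf V_{h,0}^p:\mathbf b(\hat{\mathbf u}_h^{j+1};\mathbf v,w)=0\ \forall w\in V_{h,0}^p\}$ satisfies, for all $\mathbf v\in\mathbf T_h^j$, $$(\dot{\mathbf u}_h^{j+1},\mathbf v)+\frac{\tau}{\delta_0^{(\kappa)}}(\nabla\dot{\mathbf u}_h^{j+1},\nabla\mathbf v)=\sum_{i=1}^{\kappa}\frac{\delta_i^{(\kappa)}}{\delta_0^{(\kappa)}}(\nabla\mathbf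 u_h^{j+1-i},\nabla\mathbf v).$$ **Statement.** There is a constant $\beta=\beta(\mathbf u)>0$ with the following property. Let $p,k\in\{1,2\}$, and consider any family of such discretizations $(\mathcal T_h,\tau)$ with uniformly shape-regular and quasi-uniform triangulations, and their TFEM iterates. Assume that the iterates converge uniformly to $\mathbf u$: for every $\varepsilon\in(0,1]$ there are $\varepsilon_1,\varepsilon_2>0$ such that $$\max_{0\le j\le J}\|\mathbf u_h^j-\mathbf u(t_j,\cdot)\|_{L^\infty(D_h)}\le\varepsilon\quad\text{for all discretizations of the family with }\tau\le\varepsilon_1,\ h\le\varepsilon_2.$$ Then there are $\tau_0,h_0>0$ such that for all discretizations of the family with $\tau\le\tau_0$, $h\le h_0$ and all $0\le j\le J-1$: 1. $\displaystyle\sup_{\mathbf v_h\in\mathbf V_{h,0}^p}\frac{\mathbf b(\hat{\mathbf u}_h^{j+1};\mathbf v_h,w_h)}{\|\mathbf v_h\|_{L^2}}\ge\beta\,\|w_h\|_{L^2}$ for all $w_h\in V_{h,0}^p$ (with the quotient read as $0$ for $\mathbf v_h=0$); 2. the TFEM saddle point problem is well-posed: there is exactly one pair $(\dot{\mathbf u},\lambda)\in\mathbf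 V_{h,0}^p\times V_{h,0}^p$ such that for all $\mathbf v\in\mathbf V_{h,0}^p$ and $w\in V_{h,0}^p$ $$(\dot{\mathbf u},\mathbf v)+\frac{\tau}{\delta_0^{(\kappa)}}(\nabla\dot{\mathbf u},\nabla\mathbf v)+\mathbf b(\hat{\mathbf u}_h^{j+1};\mathbf v,\lambda)=\sum_{i=1}^{\kappa}\frac{\delta_i^{(\kappa)}}{\delta_0^{(\kappa)}}(\nabla\mathbf u_h^{j+1-i},\nabla\mathbf v),\qquad \mathbf b(\hat{\mathbf u}_h^{j+1};\dot{\mathbf u},w)=0.$$ -/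

import Mathlib

open Set Metric MeasureTheory
open scoped Laplacian

noncomputable section

namespace TFEM

/-- The plane with its Euclidean norm. -/
abbrev Plane := EuclideanSpace ℝ (Fin 2)

/-- Three-dimensional space with its Euclidean norm. -/
abbrev Space := EuclideanSpace ℝ (Fin 3)

/-! ### The harmonic map heat flow on the unit disk -/

/-- `|∇ f (x)|² = ∑ i, |∂ᵢ f (x)|²`. -/
def gradSq (f : Plane → Space) (x : Plane) : ℝ :=
  ∑ i : Fin 2, ‖fderiv ℝ f x (EuclideanSpace.single i 1)‖ ^ 2

/-- `u` is a classical solution of the harmonic map heat flow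
`∂ₜ u = Δ u + |∇ u|² u` on the open unit disk for `t ∈ (0, T]`, with initial and (Dirichlet)
boundary values `u₀`. The smoothness that is required is `C¹` on `[0, T] × closure D` and
`C²` in space on `D`. -/
structure IsSmoothHMHFSolution (T : ℝ) (u₀ : Plane → Space) (u : ℝ → Plane → Space) :
    Prop where
  contDiffOn : ContDiffOn ℝ 1 (fun q : ℝ × Plane => u q.1 q.2)
    (Icc 0 T ×ˢ closedBall (0 : Plane) 1)
  contDiffOn_space : ∀ t ∈ Ioc 0 T, ContDiffOn ℝ 2 (u t) (ball 0 1)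
  pde : ∀ t ∈ Ioc 0 T, ∀ x ∈ ball (0 : Plane) 1,
    HasDerivWithinAt (fun s => u s x) (Δ (u t) x + gradSq (u t) x • u t x) (Icc 0 T) t
  initial : ∀ x ∈ ball (0 : Plane) 1, u 0 x = u₀ x
  boundary : ∀ t ∈ Icc 0 T, ∀ x ∈ sphere (0 : Plane) 1, u t x = u₀ x

/-! ### Triangulations of the disk -/

/-- The reference triangle. -/
def refTriangle : Set Plane := {x | 0 ≤ x 0 ∧ 0 ≤ x 1 ∧ x 0 + x 1 ≤ 1}

/-- Barycentric coordinates on the reference triangle. -/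
def bary (x : Plane) : Fin 3 → ℝ := ![1 - x 0 - x 1, x 0, x 1]

/-- The affine map of the reference triangle onto the triangle `K`. -/
def affMap (K : Affine.Triangle ℝ Plane) (x : Plane) : Plane := ∑ i, bary x i • K.points i

/-- The closed triangle as a set. -/
def hull (K : Affine.Triangle ℝ Plane) : Set Plane := convexHull ℝ (range K.points)

/-- The union of the (closed, straight) triangles. -/
def polygon (cells : Finset (Affine.Triangle ℝ Plane)) : Set Plane := ⋃ K ∈ cells, hull K

/-- The midpoint of the edge of `K` opposite to its vertex `i`. -/
def edgeMid (K : Affine.Triangle ℝ Plane) (i : Fin 3) : Plane :=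
  midpoint ℝ (K.points (i + 1)) (K.points (i + 2))

open Classical in
/-- The displacement of the midpoint of the edge of `K` opposite to the vertex `i` in the
quadratic isoparametric construction: the midpoint of a boundary edge is moved radially onto the
unit circle, the midpoint of an interior edge stays where it is. (An edge of a triangulation of
a convex polygon is a boundary edge iff its midpoint is a boundary point of the polygon.) -/
def bulge (cells : Finset (Affine.Triangle ℝ Plane)) (K : Affine.Triangle ℝ Plane)
    (i : Fin 3) : Plane :=
  if edgeMid K i ∈ frontier (polygon cells) then ‖edgeMid K i‖⁻¹ • edgeMid K i - edgeMid K i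
  else 0

/-- The element map: affine if `iso = false`; for `iso = true` the quadratic map that sends the
vertices of the reference triangle to the vertices of `K` and the edge midpoints to the
(displaced) edge midpoints. -/
def elementMap (cells : Finset (Affine.Triangle ℝ Plane)) (iso : Bool)
    (K : Affine.Triangle ℝ Plane) (x : Plane) : Plane :=
  affMap K x +
    if iso then ∑ i, (4 * bary x (i + 1) * bary x (i + 2)) • bulge cells K i else 0

/-- A conforming triangulation of the unit disk with all boundary vertices on the unit circle,
with straight (`iso = false`) or quadratic isoparametric (`iso = true`) elements. -/
structure DiskMesh where
  cells : Finset (Affine.Triangle ℝ Plane)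
  iso : Bool
  nonempty : cells.Nonempty
  /-- No triangle is listed twice with different orderings of its vertices. -/
  injOn : InjOn (fun K : Affine.Triangle ℝ Plane => range K.points) cells
  /-- Two triangles meet in a common face (a vertex, an edge, or nothing). -/
  conforming : ∀ K ∈ cells, ∀ L ∈ cells, K ≠ L →
    hull K ∩ hull L = convexHull ℝ (range K.points ∩ range L.points)
  /-- The straight triangles fill a convex polygon inscribed in the unit circle. -/
  inscribed : polygon cells = convexHull ℝ {z | (∃ K ∈ cells, z ∈ range K.points) ∧ ‖z‖ = 1}
  /-- The vertices on the boundary lie on the unit circle. -/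
  boundary_vertex : ∀ K ∈ cells, ∀ i, K.points i ∈ frontier (polygon cells) → ‖K.points i‖ = 1
  /-- The (possibly curved) elements lie in the closed disk. -/
  element_subset : ∀ K ∈ cells, elementMap cells iso K '' refTriangle ⊆ closedBall 0 1
  /-- The (possibly curved) elements are not folded and do not overlap: the map from the straight
  triangulation to the possibly curved one is injective. -/
  element_inj : ∀ K ∈ cells, ∀ L ∈ cells, ∀ x ∈ refTriangle, ∀ y ∈ refTriangle,
    elementMap cells iso K x = elementMap cells iso L y → affMap K x = affMap L y

namespace DiskMesh

variable (M : DiskMesh)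

/-- The element map of the triangle `K` of the mesh. -/
def map (K : Affine.Triangle ℝ Plane) : Plane → Plane := elementMap M.cells M.iso K

/-- The discrete domain `D_h`: the union of the elements. -/
def domain : Set Plane := ⋃ K ∈ M.cells, M.map K '' refTriangle

/-- The mesh parameter `h`: the largest diameter of a triangle. -/
def h : ℝ := M.cells.sup' M.nonempty fun K => diam (hull K)

/-- Shape regularity and quasi-uniformity with constant `σ`. -/
def IsQuasiUniform (σ : ℝ) : Prop :=
  ∀ K ∈ M.cells, (∃ c, closedBall c (diam (hull K) / σ) ⊆ hull K) ∧ M.h ≤ σ * diam (hull K)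

/-! ### Finite element spaces -/

/-- Reference positions of the Lagrange nodes of degree `p`. -/
def refNodes (p : ℕ) : Set Plane :=
  {x ∈ refTriangle | ∃ a b : ℕ, (p : ℝ) * x 0 = a ∧ (p : ℝ) * x 1 = b}

/-- The Lagrange nodes of degree `p` of the mesh. -/
def nodes (p : ℕ) : Set Plane := {z | ∃ K ∈ M.cells, ∃ x ∈ refNodes p, z = M.map K x}

/-- The Lagrange nodes of degree `p` on the boundary of the mesh. -/
def bdryNodes (p : ℕ) : Set Plane :=
  {z | ∃ K ∈ M.cells, ∃ x ∈ refNodes p, affMap K x ∈ frontier (polygon M.cells) ∧ z = M.map K x}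

/-- `V_h^p`: continuous functions on `D_h` that are polynomials of degree at most `p` on each
element, in the variable of the reference triangle. For straight elements these
are the polynomials of degree at most `p` on the element itself. Functions on `D_h` are
represented by functions on the plane that vanish outside `D_h`. -/
def V (p : ℕ) : Set (Plane → ℝ) :=
  {v | ContinuousOn v M.domain ∧ (∀ x ∉ M.domain, v x = 0) ∧
    ∀ K ∈ M.cells, ∃ q : MvPolynomial (Fin 2) ℝ, q.totalDegree ≤ p ∧
      ∀ x ∈ refTriangle, v (M.map K x) = MvPolynomial.eval (fun i => x i) q}

/-- `V_{h,0}^p`: the functions in `V_h^p` that vanish at the boundary nodes, that is,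
on the boundary of `D_h`. -/
def V0 (p : ℕ) : Set (Plane → ℝ) := {v ∈ M.V p | ∀ z ∈ M.bdryNodes p, v z = 0}

/-- The vector valued space `[V_h^p]³`. -/
def VVec (p : ℕ) : Set (Plane → Space) := {v | ∀ i, (fun x => v x i) ∈ M.V p}

/-- The vector valued space `[V_{h,0}^p]³`. -/
def V0Vec (p : ℕ) : Set (Plane → Space) := {v | ∀ i, (fun x => v x i) ∈ M.V0 p}

/-- `v` is the nodal interpolation of `g` in `[V_h^p]³`. -/
def IsInterpolant (p : ℕ) (g v : Plane → Space) : Prop :=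
  v ∈ M.VVec p ∧ ∀ z ∈ M.nodes p, v z = g z

/-! ### Bilinear forms -/

/-- The `L²` scalar product on `D_h`. -/
def l2Inner {F : Type*} [NormedAddCommGroup F] [InnerProductSpace ℝ F] (v w : Plane → F) : ℝ :=
  ∫ x in M.domain, inner ℝ (v x) (w x)

/-- The `L²` norm on `D_h`. -/
def l2Norm {F : Type*} [NormedAddCommGroup F] [InnerProductSpace ℝ F] (v : Plane → F) : ℝ :=
  √(M.l2Inner v v)

/-- `(∇ v, ∇ w)` on `D_h`. Finite element functions are differentiable in the interior of the
elements, hence almost everywhere on `D_h`. -/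
def gradInner (v w : Plane → Space) : ℝ :=
  ∫ x in M.domain, ∑ i : Fin 2, inner ℝ (fderiv ℝ v x (EuclideanSpace.single i 1))
    (fderiv ℝ w x (EuclideanSpace.single i 1))

/-- The constraint form `b(a; v, w) = (a · v, w)`. -/
def b (a v : Plane → Space) (w : Plane → ℝ) : ℝ :=
  M.l2Inner (fun x => inner ℝ (a x) (v x)) w

/-- The discrete tangent space `T_{h,0}^p(a)`. -/
def tangent (p : ℕ) (a : Plane → Space) : Set (Plane → Space) :=
  {v ∈ M.V0Vec p | ∀ w ∈ M.V0 p, M.b a v w = 0}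

end DiskMesh

/-! ### The tangential finite element method -/

/-- The coefficients `δ_i^{(k)}` of the backward differentiation formulas BDF1 and BDF2. -/
def bdf : ℕ → ℕ → ℝ
  | 1, 0 => 1
  | 1, 1 => -1
  | 2, 0 => 3 / 2
  | 2, 1 => -2
  | 2, 2 => 1 / 2
  | _, _ => 0

/-- The order used in the step from `t_j` to `t_{j+1}` of the BDF`k` scheme, `k ∈ {1, 2}`: the
first step of BDF2 is a BDF1 step. -/
def stepOrder (k j : ℕ) : ℕ := min k (j + 1)

/-- The normalized extrapolation `û^{j+1,(k)}` to time `t_{j+1}`: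
`u^j / |u^j|` for `k = 1` and `(2 u^j - u^{j-1}) / |2 u^j - u^{j-1}|` for `k = 2`. -/
def extrapolation (k : ℕ) (U : ℕ → Plane → Space) (j : ℕ) (x : Plane) : Space :=
  let y : Space := if k = 1 then U j x else (2 : ℝ) • U j x - U (j - 1) x
  ‖y‖⁻¹ • y

/-- The extrapolation that occurs in the step from `t_j` to `t_{j+1}` of the BDF`k` scheme. -/
def uHat (k : ℕ) (U : ℕ → Plane → Space) (j : ℕ) : Plane → Space :=
  extrapolation (stepOrder k j) U j

/-- The left-hand side `(w, v) + τ / δ₀ (∇ w, ∇ v)` of a step of order `κ`. -/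
def stepForm (M : DiskMesh) (κ : ℕ) (τ : ℝ) (w v : Plane → Space) : ℝ :=
  M.l2Inner w v + τ / bdf κ 0 * M.gradInner w v

/-- The right-hand side `∑_{i=1}^κ δ_i / δ₀ (∇ u^{j+1-i}, ∇ v)` of a step of order `κ`. -/
def stepRhs (M : DiskMesh) (κ : ℕ) (U : ℕ → Plane → Space) (j : ℕ) (v : Plane → Space) : ℝ :=
  ∑ i ∈ Finset.Icc 1 κ, bdf κ i / bdf κ 0 * M.gradInner (U (j + 1 - i)) v

/-- `U 0, …, U J` are the iterates of the tangential finite element method of degree `p` with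
BDF`k` and time step `τ` on the mesh `M`, for the initial value `u₀`. -/
structure IsTFEM (M : DiskMesh) (p k : ℕ) (τ : ℝ) (J : ℕ) (u₀ : Plane → Space)
    (U : ℕ → Plane → Space) : Prop where
  initial : M.IsInterpolant p u₀ (U 0)
  step : ∀ j < J, ∃ du ∈ M.tangent p (uHat k U j),
    (∀ v ∈ M.tangent p (uHat k U j),
      stepForm M (stepOrder k j) τ du v = stepRhs M (stepOrder k j) U j v) ∧
    ∀ x, U (j + 1) x = (τ / bdf (stepOrder k j) 0) • du x -
      ∑ i ∈ Finset.Icc 1 (stepOrder k j),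
        (bdf (stepOrder k j) i / bdf (stepOrder k j) 0) • U (j + 1 - i) x

/-- The pair `(du, lam)` solves the saddle point problem of the step from `t_j` to `t_{j+1}`. -/
def IsSaddleSolution (M : DiskMesh) (p k : ℕ) (τ : ℝ) (U : ℕ → Plane → Space) (j : ℕ)
    (s : (Plane → Space) × (Plane → ℝ)) : Prop :=
  s.1 ∈ M.V0Vec p ∧ s.2 ∈ M.V0 p ∧
  (∀ v ∈ M.V0Vec p, stepForm M (stepOrder k j) τ s.1 v + M.b (uHat k U j) v s.2 =
    stepRhs M (stepOrder k j) U j v) ∧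
  ∀ w ∈ M.V0 p, M.b (uHat k U j) s.1 w = 0

/-- The discrete inf-sup property of `b(a; ·, ·)` with constant `β`. The supremum is taken in the
extended reals; the quotient is `0` for `v = 0`. -/
def InfSup (M : DiskMesh) (p : ℕ) (a : Plane → Space) (β : ℝ) : Prop :=
  ∀ w ∈ M.V0 p, ((β * M.l2Norm w : ℝ) : EReal) ≤
    ⨆ v ∈ M.V0Vec p, ((M.b a v w / M.l2Norm v : ℝ) : EReal)

end TFEM

end

noncomputable section

namespace TFEM

open Filter Topology

/-! ### The maximum principle and the length constraint -/

/-! The exact solution has unit length: `ρ = |u|² - 1` solves the linear equation `∂ₜρ = Δρ +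
2|∇u|²ρ` with zero initial and boundary values, and `|∇u|²` is bounded, so the maximum principle for
`ρ` and `-ρ` gives `ρ = 0` (`IsSmoothHMHFSolution.norm_eq_one`). By uniform convergence the
unnormalized extrapolations are close to `g = u(t_j)`, and their normalizations `a` stay within
`1/4` of this unit field. Uniform continuity makes the oscillation of `g` on small elements as small
as desired.

For the inf-sup condition (`exists_infSup`), `w` is tested with the nodal interpolant `v` of `g w`,
which is admissible because `w` vanishes at the boundary nodes. On an element, `v - g w` is bounded
by the oscillation of `g` times the maximum of `|w|`, and that maximum is controlled by the `L²`
norm of `w` on the element, with the correct scaling (`exists_sq_mul_le`). Since `a · g ≥ 31/32`,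
this yields `b(a; v, w) ≥ 15/16 ‖w‖²` and `‖v‖² ≤ 2 ‖w‖²`, hence the constant `1/2`.

The elementwise estimate is transported from the reference triangle by the element maps. Their
Jacobians are nearly constant for small `h`, because edge midpoints move by `O(h²)` only
(`IsQuasiUniform.isRegular`). Conformity makes interpolants single-valued across elements
(`sum_shape_eq`).

The saddle point problem is a square linear system, so injectivity suffices (`existsUnique_saddle`):
a homogeneous solution satisfies the constraint, testing it with itself kills the primal part, and
inf-sup kills the multiplier. -/

theorem fderiv_fderiv_nonpos_of_isLocalMax {E : Type*} [NormedAddCommGroup E] [NormedSpace ℝ E]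
    {f : E → ℝ} {x : E} (hf : ContDiffAt ℝ 2 f x) (h : IsLocalMax f x) (e : E) :
    fderiv ℝ (fderiv ℝ f) x e e ≤ 0 := by
  by_contra! hpos
  have hline : Continuous fun s : ℝ => x + s • e := by fun_prop
  have hlim : Tendsto (fun s : ℝ => x + s • e) (𝓝 0) (𝓝 x) := by
    simpa using hline.tendsto 0
  have hdl : ∀ s : ℝ, HasDerivAt (fun s : ℝ => x + s • e) e s := fun s => by
    simpa using ((hasDerivAt_id s).smul_const e).const_add x
  have hd : ∀ᶠ y in 𝓝 x, DifferentiableAt ℝ f y :=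
    (hf.eventually (by simp)).mono fun y hy => hy.differentiableAt (by simp)
  have hφ : ∀ᶠ s : ℝ in 𝓝 0,
      HasDerivAt (fun s : ℝ => f (x + s • e)) (fderiv ℝ f (x + s • e) e) s :=
    (hlim.eventually hd).mono fun s hs => hs.hasFDerivAt.comp_hasDerivAt s (hdl s)
  have hφ' : deriv (fun s : ℝ => f (x + s • e)) =ᶠ[𝓝 0] fun s => fderiv ℝ f (x + s • e) e :=
    hφ.mono fun s hs => hs.deriv
  have hd2 : DifferentiableAt ℝ (fderiv ℝ f) x :=
    (hf.fderiv_right (m := 1) (by norm_num)).differentiableAt (by simp)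
  have h2 : HasDerivAt (fun s : ℝ => fderiv ℝ f (x + s • e) e)
      (fderiv ℝ (fderiv ℝ f) x e e) 0 := by
    have h0 : HasFDerivAt (fderiv ℝ f) (fderiv ℝ (fderiv ℝ f) x) (x + (0 : ℝ) • e) := by
      simpa using hd2.hasFDerivAt
    have h1 : HasDerivAt (fun s : ℝ => fderiv ℝ f (x + s • e)) (fderiv ℝ (fderiv ℝ f) x e) 0 :=
      h0.comp_hasDerivAt (0 : ℝ) (hdl 0)
    exact (h1.clm_apply (hasDerivAt_const (0 : ℝ) e)).congr_deriv (by simp)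
  have hdd : deriv (deriv fun s : ℝ => f (x + s • e)) 0 = fderiv ℝ (fderiv ℝ f) x e e := by
    rw [hφ'.deriv_eq, h2.deriv]
  have hmax : IsLocalMax (fun s : ℝ => f (x + s • e)) 0 := by
    have := hlim.eventually h
    simpa [IsLocalMax, IsMaxFilter] using this
  -- A positive second derivative would make the critical point a local minimum as well. The
  -- restriction to the line would then be constant near 0, with vanishing second derivative.
  have hmin : IsLocalMin (fun s : ℝ => f (x + s • e)) 0 :=
    isLocalMin_of_deriv_deriv_pos (by rw [hdd]; exact hpos) hmax.deriv_eq_zero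
      hφ.self_of_nhds.continuousAt
  have hconst : (fun s : ℝ => f (x + s • e)) =ᶠ[𝓝 0] fun _ => f (x + (0 : ℝ) • e) := by
    filter_upwards [hmax, hmin] with s h1 h2 using le_antisymm h1 h2
  have h3 : deriv (fun s : ℝ => f (x + s • e)) =ᶠ[𝓝 0] fun _ => 0 := by
    have := hconst.deriv
    simpa using this
  have : deriv (deriv fun s : ℝ => f (x + s • e)) 0 = 0 := by
    rw [h3.deriv_eq]; simp
  linarith

theorem laplacian_nonpos_of_isLocalMax {f : Plane → ℝ} {x : Plane} (hf : ContDiffAt ℝ 2 f x)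
    (h : IsLocalMax f x) : Δ f x ≤ 0 := by
  rw [InnerProductSpace.laplacian_eq_iteratedFDeriv_orthonormalBasis f
    (EuclideanSpace.basisFun (Fin 2) ℝ)]
  refine Finset.sum_nonpos fun i _ => ?_
  rw [iteratedFDeriv_two_apply]
  exact fderiv_fderiv_nonpos_of_isLocalMax hf h _

/-- The parabolic maximum principle for `∂ₜ f = Δ f + c f` with `c` bounded above. -/
theorem parabolic_max_principle {T C : ℝ} {f c : ℝ → Plane → ℝ}
    (hcont : ContinuousOn (fun q : ℝ × Plane => f q.1 q.2) (Icc 0 T ×ˢ closedBall 0 1))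
    (h0 : ∀ x ∈ ball (0 : Plane) 1, f 0 x ≤ 0)
    (hb : ∀ t ∈ Icc 0 T, ∀ x ∈ sphere (0 : Plane) 1, f t x ≤ 0)
    (hf : ∀ t ∈ Ioc 0 T, ∀ x ∈ ball (0 : Plane) 1, ContDiffAt ℝ 2 (f t) x)
    (hpde : ∀ t ∈ Ioc 0 T, ∀ x ∈ ball (0 : Plane) 1,
      HasDerivWithinAt (fun s => f s x) (Δ (f t) x + c t x * f t x) (Icc 0 T) t)
    (hc : ∀ t ∈ Ioc 0 T, ∀ x ∈ ball (0 : Plane) 1, c t x ≤ C) :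
    ∀ t ∈ Icc 0 T, ∀ x ∈ closedBall (0 : Plane) 1, f t x ≤ 0 := by
  intro t₁ ht₁ x₁ hx₁
  by_contra! hpos
  -- The exponential factor replaces the coefficient `c` by `c - (C + 1) ≤ -1`, which excludes a
  -- positive maximum off the parabolic boundary.
  set g : ℝ × Plane → ℝ := fun q => Real.exp (-(C + 1) * q.1) * f q.1 q.2 with hg
  have hgc : ContinuousOn g (Icc 0 T ×ˢ closedBall 0 1) :=
    ContinuousOn.mul (by fun_prop) hcont
  obtain ⟨⟨t, x⟩, ⟨ht, hx⟩, hmax⟩ := (isCompact_Icc.prod (isCompact_closedBall (0 : Plane) 1)).exists_isMaxOn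
    ⟨(t₁, x₁), ht₁, hx₁⟩ hgc
  simp only at ht hx
  have hmax' : ∀ s ∈ Icc 0 T, ∀ y ∈ closedBall (0 : Plane) 1, g (s, y) ≤ g (t, x) :=
    fun s hs y hy => hmax (show (s, y) ∈ _ from ⟨hs, hy⟩)
  have hfp : 0 < f t x := by
    have h1 : 0 < g (t₁, x₁) := mul_pos (Real.exp_pos _) hpos
    have h2 := h1.trans_le (hmax' t₁ ht₁ x₁ hx₁)
    exact (mul_pos_iff_of_pos_left (Real.exp_pos _)).1 h2
  have hxb : x ∈ ball (0 : Plane) 1 := by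
    rcases (mem_closedBall.1 hx).lt_or_eq with h | h
    · exact h
    · exact absurd (hb t ht x h) (not_le.2 hfp)
  have ht0 : 0 < t := by
    rcases ht.1.lt_or_eq with h | h
    · exact h
    · subst h; exact absurd (h0 x hxb) (not_le.2 hfp)
  have htI : t ∈ Ioc 0 T := ⟨ht0, ht.2⟩
  have hlap : Δ (f t) x ≤ 0 := by
    refine laplacian_nonpos_of_isLocalMax (hf t htI x hxb) ?_
    filter_upwards [isOpen_ball.mem_nhds hxb] with y hy
    exact le_of_mul_le_mul_left (hmax' t ht y (ball_subset_closedBall hy)) (Real.exp_pos _)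
  have hder : HasDerivWithinAt (fun s => g (s, x))
      (Real.exp (-(C + 1) * t) * (Δ (f t) x + c t x * f t x - (C + 1) * f t x)) (Icc 0 T) t := by
    have h1 : HasDerivAt (fun s => Real.exp (-(C + 1) * s))
        (Real.exp (-(C + 1) * t) * (-(C + 1))) t := by
      simpa using ((hasDerivAt_id t).const_mul (-(C + 1))).exp
    refine (h1.hasDerivWithinAt.mul (hpde t htI x hxb)).congr_deriv ?_
    ring
  -- The maximum may sit at `t = T`, so only the backward direction `0 - t` is used; it gives a
  -- nonnegative time derivative.
  have hle := IsLocalMaxOn.hasFDerivWithinAt_nonpos (s := Icc 0 T) (a := t) (y := 0 - t)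
    (f := fun s => g (s, x))
    (IsMaxOn.localize fun s hs => hmax' s hs x hx) hder.hasFDerivWithinAt
    (mem_posTangentConeAt_of_segment_subset (by
      simpa using (convex_Icc 0 T).segment_subset ht (⟨le_rfl, ht.1.trans ht.2⟩)))
  simp only [zero_sub, ContinuousLinearMap.toSpanSingleton_apply, smul_eq_mul] at hle
  have h5 : 0 ≤ Δ (f t) x + c t x * f t x - (C + 1) * f t x := by
    by_contra! h
    have := mul_pos ht0 (mul_pos (Real.exp_pos (-(C + 1) * t)) (neg_pos.2 h))
    nlinarith
  have h6 := hc t htI x hxb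
  nlinarith

/-- Product rule, applied twice in each coordinate direction. Combined with the flow equation it
closes up to a scalar linear equation for `|u|² - 1`. -/
theorem laplacian_norm_sq {v : Plane → Space} {x : Plane} (hv : ContDiffAt ℝ 2 v x) :
    Δ (fun y => ‖v y‖ ^ 2 - 1 : Plane → ℝ) x = 2 * inner ℝ (v x) (Δ v x) + 2 * gradSq v x := by
  rw [InnerProductSpace.laplacian_eq_iteratedFDeriv_orthonormalBasis _
    (EuclideanSpace.basisFun (Fin 2) ℝ),
    InnerProductSpace.laplacian_eq_iteratedFDeriv_orthonormalBasis _
    (EuclideanSpace.basisFun (Fin 2) ℝ), inner_sum, gradSq, Finset.mul_sum, Finset.mul_sum,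
    ← Finset.sum_add_distrib]
  refine Finset.sum_congr rfl fun i _ => ?_
  rw [iteratedFDeriv_two_apply, iteratedFDeriv_two_apply]
  simp only [EuclideanSpace.basisFun_apply, Matrix.cons_val_zero, Matrix.cons_val_one]
  set e : Plane := EuclideanSpace.single i 1
  have hd : ∀ᶠ y in 𝓝 x, DifferentiableAt ℝ v y :=
    (hv.eventually (by simp)).mono fun y hy => hy.differentiableAt (by simp)
  have hd2 : DifferentiableAt ℝ (fderiv ℝ v) x :=
    (hv.fderiv_right (m := 1) (by norm_num)).differentiableAt (by simp)
  have h1 : (fderiv ℝ fun y => ‖v y‖ ^ 2 - 1) =ᶠ[𝓝 x]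
      fun y => 2 • (innerSL ℝ (v y)).comp (fderiv ℝ v y) :=
    hd.mono fun y hy => (hy.hasFDerivAt.norm_sq.sub_const 1).fderiv
  have h1' : ContDiffAt ℝ 2 (fun y => ‖v y‖ ^ 2 - 1) x := (hv.norm_sq ℝ).sub contDiffAt_const
  have h2d : DifferentiableAt ℝ (fderiv ℝ fun y => ‖v y‖ ^ 2 - 1) x :=
    (h1'.fderiv_right (m := 1) (by norm_num)).differentiableAt (by simp)
  have h3 : (fun y => (fderiv ℝ (fun y => ‖v y‖ ^ 2 - 1) y) e) =ᶠ[𝓝 x]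
      fun y => 2 * inner ℝ (v y) (fderiv ℝ v y e) := by
    filter_upwards [h1] with y hy
    rw [hy]; simp [two_mul, two_smul]
  have h4 : fderiv ℝ (fderiv ℝ fun y => ‖v y‖ ^ 2 - 1) x e e =
      fderiv ℝ (fun y => (fderiv ℝ (fun y => ‖v y‖ ^ 2 - 1) y) e) x e := by
    rw [fderiv_clm_apply h2d (differentiableAt_const e)]; simp
  have h5 : HasFDerivAt (fun y => fderiv ℝ v y e) ((fderiv ℝ (fderiv ℝ v) x).flip e) x := by
    have := hd2.hasFDerivAt.clm_apply (hasFDerivAt_const e x)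
    simpa using this
  have h6 := (hd.self_of_nhds.hasFDerivAt.inner ℝ h5).const_mul 2
  rw [h4, h3.fderiv_eq, h6.fderiv]
  simp [fderivInnerCLM_apply]
  ring

/-- Supplies the bound on the zeroth-order coefficient required by the maximum principle: the
space-time derivative is continuous on the compact cylinder, and the spatial derivative is its
restriction to directions `(0, e)`. -/
theorem gradSq_bounded {T : ℝ} (hT : 0 < T) {u : ℝ → Plane → Space}
    (hu : ContDiffOn ℝ 1 (fun q : ℝ × Plane => u q.1 q.2) (Icc 0 T ×ˢ closedBall (0 : Plane) 1)) :
    ∃ C, ∀ t ∈ Icc 0 T, ∀ x ∈ ball (0 : Plane) 1, gradSq (u t) x ≤ C := by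
  set S : Set (ℝ × Plane) := Icc 0 T ×ˢ closedBall (0 : Plane) 1
  have hU : UniqueDiffOn ℝ S := (uniqueDiffOn_Icc hT).prod
    (uniqueDiffOn_convex (convex_closedBall _ _)
      ⟨0, by rw [interior_closedBall _ one_ne_zero]; simp⟩)
  have hc := hu.continuousOn_fderivWithin hU le_rfl
  obtain ⟨B, hB⟩ := ((isCompact_Icc.prod (isCompact_closedBall (0 : Plane) 1)).image_of_continuousOn
    hc).isBounded.exists_norm_le
  refine ⟨∑ i : Fin 2, B ^ 2, fun t ht x hx => Finset.sum_le_sum fun i _ => ?_⟩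
  have hmem : (t, x) ∈ S := ⟨ht, ball_subset_closedBall hx⟩
  have h1 := (hu.differentiableOn one_ne_zero (t, x) hmem).hasFDerivWithinAt
  have h2 : HasFDerivWithinAt (fun y : Plane => (t, y)) (ContinuousLinearMap.inr ℝ ℝ Plane)
      (closedBall 0 1) x := (hasFDerivAt_prodMk_right t x).hasFDerivWithinAt
  have h3 := h1.comp x h2 (fun y hy => ⟨ht, hy⟩)
  have h4 := (h3.hasFDerivAt (mem_of_superset (isOpen_ball.mem_nhds hx) ball_subset_closedBall))
  have h5 : fderiv ℝ (u t) x = _ := h4.fderiv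
  rw [h5]
  have h6 := hB _ (mem_image_of_mem _ hmem)
  have h7 : ‖(fderivWithin ℝ (fun q : ℝ × Plane => u q.1 q.2) S (t, x))
      (0, EuclideanSpace.single i 1)‖ ≤ B := by
    refine (ContinuousLinearMap.le_opNorm _ _).trans ?_
    simpa [Prod.norm_def] using h6
  simpa using pow_le_pow_left₀ (norm_nonneg _) h7 2

/-- Solutions of the harmonic map heat flow with unit length data have unit length. -/
theorem IsSmoothHMHFSolution.norm_eq_one {T : ℝ} (hT : 0 < T) {u₀ : Plane → Space}
    (hu₀ : ∀ x ∈ closedBall (0 : Plane) 1, ‖u₀ x‖ = 1) {u : ℝ → Plane → Space}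
    (hu : IsSmoothHMHFSolution T u₀ u) :
    ∀ t ∈ Icc 0 T, ∀ x ∈ closedBall (0 : Plane) 1, ‖u t x‖ = 1 := by
  obtain ⟨C, hC⟩ := gradSq_bounded hT hu.contDiffOn
  have hC2 : ∀ t ∈ Ioc 0 T, ∀ x ∈ ball (0 : Plane) 1, ContDiffAt ℝ 2 (u t) x := fun t ht x hx =>
    (hu.contDiffOn_space t ht).contDiffAt (isOpen_ball.mem_nhds hx)
  have hρ2 : ∀ t ∈ Ioc 0 T, ∀ x ∈ ball (0 : Plane) 1,
      ContDiffAt ℝ 2 (fun y => ‖u t y‖ ^ 2 - 1) x := fun t ht x hx =>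
    ((hC2 t ht x hx).norm_sq ℝ).sub contDiffAt_const
  have hcont : ContinuousOn (fun q : ℝ × Plane => ‖u q.1 q.2‖ ^ 2 - 1)
      (Icc 0 T ×ˢ closedBall 0 1) := (hu.contDiffOn.continuousOn.norm.pow 2).sub continuousOn_const
  have h0 : ∀ x ∈ ball (0 : Plane) 1, ‖u 0 x‖ ^ 2 - 1 = 0 := fun x hx => by
    rw [hu.initial x hx, hu₀ x (ball_subset_closedBall hx)]; norm_num
  have hb : ∀ t ∈ Icc 0 T, ∀ x ∈ sphere (0 : Plane) 1, ‖u t x‖ ^ 2 - 1 = 0 := fun t ht x hx => by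
    rw [hu.boundary t ht x hx, hu₀ x (sphere_subset_closedBall hx)]; norm_num
  have hpde : ∀ t ∈ Ioc 0 T, ∀ x ∈ ball (0 : Plane) 1,
      HasDerivWithinAt (fun s => ‖u s x‖ ^ 2 - 1)
        (Δ (fun y => ‖u t y‖ ^ 2 - 1 : Plane → ℝ) x + 2 * gradSq (u t) x * (‖u t x‖ ^ 2 - 1))
        (Icc 0 T) t := fun t ht x hx => by
    refine (((hu.pde t ht x hx).norm_sq).sub_const 1).congr_deriv ?_
    rw [laplacian_norm_sq (hC2 t ht x hx), inner_add_right, inner_smul_right,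
      real_inner_self_eq_norm_sq]
    ring
  have hc : ∀ t ∈ Ioc 0 T, ∀ x ∈ ball (0 : Plane) 1, 2 * gradSq (u t) x ≤ 2 * C :=
    fun t ht x hx => by linarith [hC t ⟨ht.1.le, ht.2⟩ x hx]
  -- The equation for `|u|² - 1` is linear with zero data, so the principle applies to both signs.
  have hup := parabolic_max_principle hcont (fun x hx => (h0 x hx).le)
    (fun t ht x hx => (hb t ht x hx).le) hρ2 hpde hc
  have hdown := parabolic_max_principle (f := fun t x => -(‖u t x‖ ^ 2 - 1)) hcont.neg
    (fun x hx => by rw [h0 x hx, neg_zero]) (fun t ht x hx => by rw [hb t ht x hx, neg_zero])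
    (fun t ht x hx => (hρ2 t ht x hx).neg) (fun t ht x hx => by
      have h : Δ (fun y => -(‖u t y‖ ^ 2 - 1) : Plane → ℝ) x = -(Δ (fun y => ‖u t y‖ ^ 2 - 1 : Plane → ℝ) x) := by
        have := InnerProductSpace.laplacian_neg (f := fun y => ‖u t y‖ ^ 2 - 1)
        exact congrFun this x
      refine (hpde t ht x hx).neg.congr_deriv ?_
      rw [h]; ring) hc
  intro t ht x hx
  have h1 := hup t ht x hx
  have h2 := hdown t ht x hx
  have h3 : ‖u t x‖ ^ 2 = 1 := by linarith
  exact (pow_eq_one_iff_of_nonneg (norm_nonneg _) two_ne_zero).1 h3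

/-! ### Lagrange elements on the reference triangle -/

/-- The open reference triangle. -/
def openTriangle : Set Plane := {x | 0 < x 0 ∧ 0 < x 1 ∧ x 0 + x 1 < 1}

/-- The vertices (`inl`) and edge midpoints (`inr`) of the reference triangle. -/
def refNode : Fin 3 ⊕ Fin 3 → Plane :=
  Sum.elim ![!₂[0, 0], !₂[1, 0], !₂[0, 1]] ![!₂[1 / 2, 1 / 2], !₂[0, 1 / 2], !₂[1 / 2, 0]]

/-- The Lagrange shape functions; for `p = 1` those of the edge midpoints are set to zero. -/
def shape (p : ℕ) : Fin 3 ⊕ Fin 3 → Plane → ℝ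
  | .inl i, x => if p = 1 then bary x i else bary x i * (2 * bary x i - 1)
  | .inr i, x => if p = 1 then 0 else 4 * bary x (i + 1) * bary x (i + 2)

theorem bary_zero (x : Plane) : bary x 0 = 1 - x 0 - x 1 := rfl
theorem bary_one (x : Plane) : bary x 1 = x 0 := rfl
theorem bary_two (x : Plane) : bary x 2 = x 1 := rfl

theorem sum_bary (x : Plane) : ∑ i, bary x i = 1 := by
  simp only [Fin.sum_univ_three, bary_zero, bary_one, bary_two]; ring

theorem continuous_bary (i : Fin 3) : Continuous fun x => bary x i := by
  fin_cases i
  · change Continuous fun x : Plane => 1 - x 0 - x 1; fun_prop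
  · change Continuous fun x : Plane => x 0; fun_prop
  · change Continuous fun x : Plane => x 1; fun_prop

theorem bary_nonneg {x : Plane} (hx : x ∈ refTriangle) (i : Fin 3) : 0 ≤ bary x i := by
  obtain ⟨h0, h1, h2⟩ := hx
  fin_cases i
  · change 0 ≤ 1 - x 0 - x 1; linarith
  · exact h0
  · exact h1

theorem bary_le_one {x : Plane} (hx : x ∈ refTriangle) (i : Fin 3) : bary x i ≤ 1 := by
  rw [← sum_bary x]
  exact Finset.single_le_sum (fun j _ => bary_nonneg hx j) (Finset.mem_univ i)

theorem bary_pos {x : Plane} (hx : x ∈ openTriangle) (i : Fin 3) : 0 < bary x i := by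
  obtain ⟨h0, h1, h2⟩ := hx
  fin_cases i
  · change 0 < 1 - x 0 - x 1; linarith
  · exact h0
  · exact h1

theorem plane_ext_of_bary {x y : Plane} (h : ∀ i, bary x i = bary y i) : x = y := by
  ext i
  fin_cases i
  · exact h 1
  · exact h 2

theorem continuous_shape (p : ℕ) (n : Fin 3 ⊕ Fin 3) : Continuous (shape p n) := by
  have := continuous_bary
  rcases n with i | i
  · change Continuous fun x => if p = 1 then bary x i else bary x i * (2 * bary x i - 1)
    split_ifs <;> fun_prop
  · change Continuous fun x => if p = 1 then 0 else 4 * bary x (i + 1) * bary x (i + 2)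
    split_ifs <;> fun_prop

theorem refNode_mem (n : Fin 3 ⊕ Fin 3) : refNode n ∈ refTriangle := by
  rcases n with i | i <;> fin_cases i <;> simp [refNode, refTriangle] <;> norm_num

theorem bary_refNode_inl (i j : Fin 3) : bary (refNode (.inl i)) j = if j = i then 1 else 0 := by
  fin_cases i <;> fin_cases j <;> simp [refNode, bary]

theorem bary_refNode_inr (i j : Fin 3) : bary (refNode (.inr i)) j = if j = i then 0 else 1 / 2 := by
  fin_cases i <;> fin_cases j <;> simp [refNode, bary] <;> norm_num

theorem shape_two_refNode (n m : Fin 3 ⊕ Fin 3) :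
    shape 2 n (refNode m) = if n = m then 1 else 0 := by
  rcases n with i | i <;> rcases m with j | j <;>
    simp only [shape, bary_refNode_inl, bary_refNode_inr] <;> fin_cases i <;> fin_cases j <;>
    simp <;> norm_num

theorem shape_one_refNode (n : Fin 3 ⊕ Fin 3) (j : Fin 3) :
    shape 1 n (refNode (.inl j)) = if n = .inl j then 1 else 0 := by
  rcases n with i | i <;> simp [shape, bary_refNode_inl]

theorem abs_shape_le_one (p : ℕ) (n : Fin 3 ⊕ Fin 3) {x : Plane} (hx : x ∈ refTriangle) :
    |shape p n x| ≤ 1 := by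
  have h0 := bary_nonneg hx
  have h1 := bary_le_one hx
  have hs := sum_bary x
  rw [Fin.sum_univ_three] at hs
  rcases n with i | i <;> by_cases hp : p = 1 <;> simp only [shape, hp, if_true, if_false]
  · rw [abs_le]; constructor <;> linarith [h0 i, h1 i]
  · rw [abs_le]; constructor <;> nlinarith [h0 i, h1 i]
  · simp
  · have key : ∀ a b : ℝ, 0 ≤ a → 0 ≤ b → a + b ≤ 1 → |4 * a * b| ≤ 1 := fun a b ha hb hab => by
      rw [abs_of_nonneg (by positivity)]; nlinarith [sq_nonneg (a - b)]
    refine key _ _ (h0 _) (h0 _) ?_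
    fin_cases i <;> simp <;> linarith [h0 0, h0 1, h0 2]

/-- The shape functions are dual to the Lagrange nodes of degree `p`. -/
theorem exists_refNode_eq {p : ℕ} (hp : p = 1 ∨ p = 2) {x : Plane} (hx : x ∈ DiskMesh.refNodes p) :
    ∃ m, x = refNode m ∧ ∀ n, shape p n x = if n = m then 1 else 0 := by
  obtain ⟨⟨h0, h1, h2⟩, a, b, ha, hb⟩ := hx
  rcases hp with rfl | rfl
  · suffices h : ∃ j, x = refNode (.inl j) by
      obtain ⟨j, rfl⟩ := h
      exact ⟨.inl j, rfl, fun n => shape_one_refNode n j⟩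
    simp only [Nat.cast_one, one_mul] at ha hb
    have hab : a + b ≤ 1 := by 
      have : (a : ℝ) + b ≤ 1 := by rw [← ha, ← hb]; exact h2
      exact_mod_cast this
    have : (a = 0 ∧ b = 0) ∨ (a = 1 ∧ b = 0) ∨ (a = 0 ∧ b = 1) := by omega
    rcases this with ⟨rfl, rfl⟩ | ⟨rfl, rfl⟩ | ⟨rfl, rfl⟩
    · exact ⟨0, by ext i; fin_cases i <;> simp [refNode, ha, hb]⟩
    · exact ⟨1, by ext i; fin_cases i <;> simp [refNode, ha, hb]⟩
    · exact ⟨2, by ext i; fin_cases i <;> simp [refNode, ha, hb]⟩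
  · suffices h : ∃ m, x = refNode m by
      obtain ⟨m, rfl⟩ := h
      exact ⟨m, rfl, fun n => shape_two_refNode n m⟩
    replace ha : x 0 = a / 2 := by push_cast at ha; linarith
    replace hb : x 1 = b / 2 := by push_cast at hb; linarith
    have hab : a + b ≤ 2 := by
      have : (a : ℝ) + b ≤ 2 := by rw [ha, hb] at h2; linarith
      exact_mod_cast this
    have : (a = 0 ∧ b = 0) ∨ (a = 1 ∧ b = 0) ∨ (a = 0 ∧ b = 1) ∨ (a = 2 ∧ b = 0) ∨
      (a = 1 ∧ b = 1) ∨ (a = 0 ∧ b = 2) := by omega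
    rcases this with ⟨rfl, rfl⟩ | ⟨rfl, rfl⟩ | ⟨rfl, rfl⟩ | ⟨rfl, rfl⟩ | ⟨rfl, rfl⟩ | ⟨rfl, rfl⟩
    · exact ⟨.inl 0, by ext i; fin_cases i <;> simp [refNode, ha, hb]⟩
    · exact ⟨.inr 2, by ext i; fin_cases i <;> simp [refNode, ha, hb]⟩
    · exact ⟨.inr 1, by ext i; fin_cases i <;> simp [refNode, ha, hb]⟩
    · exact ⟨.inl 1, by ext i; fin_cases i <;> simp [refNode, ha, hb]⟩
    · exact ⟨.inr 0, by ext i; fin_cases i <;> simp [refNode, ha, hb]⟩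
    · exact ⟨.inl 2, by ext i; fin_cases i <;> simp [refNode, ha, hb]⟩

/-- By linearity, exactness of interpolation only has to be checked on the finitely many monomials.
The same six nodes serve both degrees since the midpoint functions vanish for `p = 1`. -/
theorem monomial_eq_sum_shape {p : ℕ} (hp : p = 1 ∨ p = 2) {a b : ℕ} (hab : a + b ≤ p) (x : Plane) :
    x 0 ^ a * x 1 ^ b = ∑ n, shape p n x * (refNode n 0 ^ a * refNode n 1 ^ b) := by
  have hb : b ≤ p - a := by omega
  rcases hp with rfl | rfl
  · have ha : a ≤ 1 := by omega
    interval_cases a <;> interval_cases b <;>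
      simp [Fin.sum_univ_three, shape, refNode, bary_zero, bary_one, bary_two]
    ring
  · have ha : a ≤ 2 := by omega
    interval_cases a <;> interval_cases b <;>
      simp [Fin.sum_univ_three, shape, refNode, bary_zero, bary_one, bary_two] <;> ring

/-- A polynomial of degree at most `p` is its own Lagrange interpolant. -/
theorem eval_eq_sum_shape {p : ℕ} (hp : p = 1 ∨ p = 2) {q : MvPolynomial (Fin 2) ℝ}
    (hq : q.totalDegree ≤ p) (x : Plane) :
    MvPolynomial.eval (fun i => x i) q =
      ∑ n, shape p n x * MvPolynomial.eval (fun i => refNode n i) q := by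
  simp only [MvPolynomial.eval_eq', Fin.prod_univ_two, Finset.mul_sum]
  rw [Finset.sum_comm]
  refine Finset.sum_congr rfl fun d hd => ?_
  have hdeg : d 0 + d 1 ≤ p := by
    have := (MvPolynomial.le_totalDegree hd).trans hq
    rwa [Finsupp.sum_fintype _ _ (fun _ => rfl), Fin.sum_univ_two] at this
  rw [monomial_eq_sum_shape hp hdeg, Finset.mul_sum]
  exact Finset.sum_congr rfl fun n _ => by ring

theorem exists_polynomial_bary (i : Fin 3) : ∃ q : MvPolynomial (Fin 2) ℝ, q.totalDegree ≤ 1 ∧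
    ∀ x : Plane, MvPolynomial.eval (fun i => x i) q = bary x i := by
  fin_cases i
  · refine ⟨.C 1 - .X 0 - .X 1, ?_, fun x => by simp [bary_zero]⟩
    refine (MvPolynomial.totalDegree_sub _ _).trans (max_le
      ((MvPolynomial.totalDegree_sub _ _).trans (max_le ?_ ?_)) ?_) <;> simp
  · exact ⟨.X 0, by simp, fun x => by simp [bary_one]⟩
  · exact ⟨.X 1, by simp, fun x => by simp [bary_two]⟩

theorem exists_polynomial_shape {p : ℕ} (hp : p = 1 ∨ p = 2) (n : Fin 3 ⊕ Fin 3) :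
    ∃ q : MvPolynomial (Fin 2) ℝ, q.totalDegree ≤ p ∧
      ∀ x : Plane, MvPolynomial.eval (fun i => x i) q = shape p n x := by
  choose b hb hb' using exists_polynomial_bary
  rcases hp with rfl | rfl <;> rcases n with i | i
  · exact ⟨b i, hb i, fun x => by simp [shape, hb']⟩
  · exact ⟨0, by simp, fun x => by simp [shape]⟩
  · refine ⟨b i * (.C 2 * b i - .C 1), ?_, fun x => by simp [shape, hb']⟩
    refine (MvPolynomial.totalDegree_mul _ _).trans (add_le_add (hb i) (?_ : _ ≤ 1))
    refine (MvPolynomial.totalDegree_sub _ _).trans (max_le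
      ((MvPolynomial.totalDegree_mul _ _).trans ?_) (by simp))
    simpa using hb i
  · refine ⟨.C 4 * (b (i + 1) * b (i + 2)), ?_, fun x => by simp [shape, hb', mul_assoc]⟩
    refine (MvPolynomial.totalDegree_mul _ _).trans ?_
    rw [MvPolynomial.totalDegree_C, zero_add]
    exact (MvPolynomial.totalDegree_mul _ _).trans (add_le_add (hb _) (hb _))

/-! ### Topology and measure of the reference triangle -/

theorem isOpen_openTriangle : IsOpen openTriangle := by
  refine IsOpen.and ?_ (IsOpen.and ?_ ?_)
  · exact isOpen_lt continuous_const (by fun_prop)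
  · exact isOpen_lt continuous_const (by fun_prop)
  · exact isOpen_lt (by fun_prop) continuous_const

theorem openTriangle_subset : openTriangle ⊆ refTriangle := fun _ h => ⟨h.1.le, h.2.1.le, h.2.2.le⟩

theorem isCompact_refTriangle : IsCompact refTriangle := by
  have hcl : IsClosed refTriangle := by
    refine IsClosed.and ?_ (IsClosed.and ?_ ?_)
    · exact isClosed_le continuous_const (by fun_prop)
    · exact isClosed_le continuous_const (by fun_prop)
    · exact isClosed_le (by fun_prop) continuous_const
  refine (isCompact_closedBall (0 : Plane) 2).of_isClosed_subset hcl fun x hx => ?_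
  obtain ⟨h0, h1, h2⟩ := hx
  rw [mem_closedBall_zero_iff, EuclideanSpace.norm_eq, Real.sqrt_le_left (by norm_num)]
  simp only [Fin.sum_univ_two, Real.norm_eq_abs, sq_abs]
  nlinarith

theorem refTriangle_subset_closure : refTriangle ⊆ closure openTriangle := by
  intro x hx
  obtain ⟨h0, h1, h2⟩ := hx
  -- Moving any point slightly towards the barycentre enters the open triangle.
  set c : Plane := !₂[1 / 3, 1 / 3]
  have hlim : Tendsto (fun s : ℝ => x + s • (c - x)) (𝓝[>] 0) (𝓝 x) := by
    have : Continuous fun s : ℝ => x + s • (c - x) := by fun_prop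
    simpa using (this.tendsto 0).mono_left nhdsWithin_le_nhds
  refine mem_closure_of_tendsto hlim ?_
  filter_upwards [Ioo_mem_nhdsGT (zero_lt_one' ℝ)] with s hs
  refine ⟨?_, ?_, ?_⟩ <;> simp [c] <;> nlinarith [hs.1, hs.2]

theorem convex_openTriangle : Convex ℝ openTriangle := by
  intro x hx y hy a b ha hb hab
  obtain ⟨h0, h1, h2⟩ := hx
  obtain ⟨k0, k1, k2⟩ := hy
  refine ⟨?_, ?_, ?_⟩ <;> simp only [PiLp.add_apply, PiLp.smul_apply, smul_eq_mul]
  · nlinarith [mul_nonneg ha h0.le, mul_nonneg hb k0.le, lt_min h0 k0, min_le_left (x 0) (y 0), min_le_right (x 0) (y 0)]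
  · nlinarith [mul_nonneg ha h1.le, mul_nonneg hb k1.le, lt_min h1 k1, min_le_left (x 1) (y 1), min_le_right (x 1) (y 1)]
  · rcases ha.eq_or_lt with rfl | ha'
    · simp only [zero_add] at hab; subst hab; linarith
    · nlinarith [mul_pos ha' (sub_pos.2 h2), mul_nonneg hb (sub_pos.2 k2).le]

theorem volume_refTriangle_diff : volume (refTriangle \ openTriangle) = 0 := by
  refine measure_mono_null ?_ (convex_openTriangle.addHaar_frontier volume)
  rw [isOpen_openTriangle.frontier_eq]
  exact sdiff_subset_sdiff_left refTriangle_subset_closure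

theorem volume_openTriangle_lt_top : volume openTriangle < ⊤ :=
  (measure_mono openTriangle_subset).trans_lt isCompact_refTriangle.measure_lt_top

theorem integrableOn_openTriangle {f : Plane → ℝ} (hf : ContinuousOn f refTriangle) :
    IntegrableOn f openTriangle :=
  (hf.integrableOn_compact isCompact_refTriangle).mono_set openTriangle_subset

/-- On the reference triangle, the maximum of a quadratic polynomial is controlled by its
`L²` norm. -/
theorem exists_sq_le_integral : ∃ C > (0 : ℝ), ∀ q : MvPolynomial (Fin 2) ℝ, q.totalDegree ≤ 2 →
    ∀ x ∈ refTriangle, (MvPolynomial.eval (fun i => x i) q) ^ 2 ≤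
      C * ∫ y in openTriangle, (MvPolynomial.eval (fun i => y i) q) ^ 2 := by
  set s : (Fin 3 ⊕ Fin 3 → ℝ) → Plane → ℝ := fun c x => ∑ n, shape 2 n x * c n with hs
  have hsc : ∀ c, Continuous (s c) := fun c => by
    have := continuous_shape 2
    simp only [hs]; fun_prop
  set G : (Fin 3 ⊕ Fin 3 → ℝ) → ℝ := fun c => ∫ y in openTriangle, (s c y) ^ 2 with hG
  have hGe : ∀ c, G c = ∑ n, ∑ m, c n * c m * ∫ y in openTriangle, shape 2 n y * shape 2 m y := by
    intro c
    have hi : ∀ n m, IntegrableOn (fun y => c n * c m * (shape 2 n y * shape 2 m y)) openTriangle :=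
      fun n m => integrableOn_openTriangle
        (((continuous_shape 2 n).mul (continuous_shape 2 m)).const_mul _).continuousOn
    simp only [hG, hs]
    have : ∀ y, (∑ n, shape 2 n y * c n) ^ 2 =
        ∑ n, ∑ m, c n * c m * (shape 2 n y * shape 2 m y) := fun y => by
      rw [sq, Finset.sum_mul_sum]
      exact Finset.sum_congr rfl fun n _ => Finset.sum_congr rfl fun m _ => by ring
    simp only [this]
    rw [integral_finsetSum _ fun n _ => integrable_finsetSum _ fun m _ => hi n m]
    refine Finset.sum_congr rfl fun n _ => ?_
    rw [integral_finsetSum _ fun m _ => hi n m]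
    exact Finset.sum_congr rfl fun m _ => integral_const_mul _ _
  have hGc : Continuous G := by
    rw [show G = _ from funext hGe]; fun_prop
  have hnode : ∀ c m, s c (refNode m) = c m := fun c m => by
    simp only [hs, shape_two_refNode, ite_mul, one_mul, zero_mul]
    exact (Finset.sum_ite_eq' _ _ _).trans (if_pos (Finset.mem_univ _))
  -- A continuous function that vanishes almost everywhere on the open triangle vanishes on its
  -- closure, hence at the nodes, where it takes the values `c`.
  have hGpos : ∀ c, c ≠ 0 → 0 < G c := by
    intro c hc
    refine lt_of_le_of_ne (integral_nonneg fun y => sq_nonneg _) fun h0 => hc ?_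
    have hae := (setIntegral_eq_zero_iff_of_nonneg_ae (ae_of_all _ fun y => sq_nonneg (s c y))
      (integrableOn_openTriangle ((hsc c).pow 2).continuousOn)).1 h0.symm
    have hz : EqOn (fun y => s c y ^ 2) 0 openTriangle :=
      Measure.eqOn_open_of_ae_eq hae isOpen_openTriangle ((hsc c).pow 2).continuousOn
        continuousOn_const
    funext m
    have hcl : refNode m ∈ closure openTriangle := refTriangle_subset_closure (refNode_mem m)
    have h2 := hz.closure ((hsc c).pow 2) continuous_const hcl
    rw [← hnode c m]
    simpa using h2
  -- Compactness of the unit sphere and homogeneity of degree 2 turn positivity of `G` into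
  -- coercivity.
  obtain ⟨c₀, hc₀, hmin⟩ := (isCompact_sphere (0 : Fin 3 ⊕ Fin 3 → ℝ) 1).exists_isMinOn
    (NormedSpace.sphere_nonempty.2 zero_le_one) hGc.continuousOn
  have hm : 0 < G c₀ := hGpos c₀ (by rintro rfl; simp at hc₀)
  have hlow : ∀ c, G c₀ * ‖c‖ ^ 2 ≤ G c := by
    intro c
    rcases eq_or_ne c 0 with rfl | hc
    · simpa using integral_nonneg fun y => sq_nonneg _
    · have hn : 0 < ‖c‖ := norm_pos_iff.2 hc
      have h1 := hmin (show ‖c‖⁻¹ • c ∈ sphere (0 : Fin 3 ⊕ Fin 3 → ℝ) 1 by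
        simp [norm_smul, hn.ne'])
      have h2 : G (‖c‖⁻¹ • c) = (‖c‖⁻¹) ^ 2 * G c := by
        rw [hGe, hGe, Finset.mul_sum]
        refine Finset.sum_congr rfl fun n _ => ?_
        rw [Finset.mul_sum]
        exact Finset.sum_congr rfl fun m _ => by simp only [Pi.smul_apply, smul_eq_mul]; ring
      have h3 : G c₀ ≤ (‖c‖⁻¹) ^ 2 * G c := h2 ▸ h1
      calc G c₀ * ‖c‖ ^ 2 ≤ (‖c‖⁻¹) ^ 2 * G c * ‖c‖ ^ 2 := by gcongr
        _ = G c := by field_simp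
  -- 36 = 6²: there are six shape functions, each bounded by 1, and `‖c‖` is the maximum norm.
  refine ⟨36 / G c₀, by positivity, fun q hq x hx => ?_⟩
  set c : Fin 3 ⊕ Fin 3 → ℝ := fun n => MvPolynomial.eval (fun i => refNode n i) q with hcdef
  have he : ∀ y : Plane, MvPolynomial.eval (fun i => y i) q = s c y := fun y =>
    eval_eq_sum_shape (Or.inr rfl) hq y
  simp only [he]
  have h1 : |s c x| ≤ 6 * ‖c‖ := by
    refine (Finset.abs_sum_le_sum_abs _ _).trans ?_
    refine (Finset.sum_le_card_nsmul _ _ ‖c‖ fun n _ => ?_).trans (by simp)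
    rw [abs_mul]
    have := abs_shape_le_one 2 n hx
    have h4 : |c n| ≤ ‖c‖ := norm_le_pi_norm c n
    nlinarith [abs_nonneg (c n)]
  have h2 : s c x ^ 2 ≤ 36 * ‖c‖ ^ 2 := by
    rw [← sq_abs]; nlinarith [abs_nonneg (s c x)]
  calc s c x ^ 2 ≤ 36 / G c₀ * (G c₀ * ‖c‖ ^ 2) := by field_simp; linarith
    _ ≤ _ := mul_le_mul_of_nonneg_left (hlow c) (by positivity)

/-! ### Conformity -/

/-- Affine independence of the vertices makes barycentric coordinates unique. -/
theorem eq_bary_of_sum_eq (K : Affine.Triangle ℝ Plane) {x : Plane} {c : Fin 3 → ℝ}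
    (hc : ∑ i, c i = 1) (h : ∑ i, c i • K.points i = affMap K x) (i : Fin 3) : bary x i = c i := by
  have h1 : ∑ j, (bary x j - c j) = 0 := by
    rw [Finset.sum_sub_distrib, sum_bary, hc, sub_self]
  have h2 : ∑ j, (bary x j - c j) • K.points j = 0 := by
    simp only [sub_smul, Finset.sum_sub_distrib]
    rw [h, affMap, sub_self]
  exact sub_eq_zero.1 (K.independent.eq_zero_of_sum_eq_zero h1 h2 i (Finset.mem_univ i))

theorem affMap_injective (K : Affine.Triangle ℝ Plane) : Function.Injective (affMap K) :=
  fun _ y h => plane_ext_of_bary fun i => eq_bary_of_sum_eq K (sum_bary y) h.symm i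

theorem affMap_mem_hull (K : Affine.Triangle ℝ Plane) {x : Plane} (hx : x ∈ refTriangle) :
    affMap K x ∈ hull K :=
  (convex_convexHull ℝ _).sum_mem (fun i _ => bary_nonneg hx i) (sum_bary x)
    fun i _ => subset_convexHull ℝ _ (mem_range_self i)

theorem hull_eq_image (K : Affine.Triangle ℝ Plane) : hull K = affMap K '' refTriangle := by
  refine Subset.antisymm (fun z hz => ?_) ?_
  · rw [hull, convexHull_range_eq_exists_affineCombination] at hz
    obtain ⟨s, w, hw, hs, rfl⟩ := hz
    set c : Fin 3 → ℝ := fun i => if i ∈ s then w i else 0 with hc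
    have hc0 : ∀ i, 0 ≤ c i := fun i => by
      simp only [hc]; split_ifs with h
      exacts [hw i h, le_rfl]
    have hc1 : c 0 + c 1 + c 2 = 1 := by
      rw [← Fin.sum_univ_three, ← hs]; simp [hc]
    refine ⟨!₂[c 1, c 2], ⟨hc0 1, hc0 2, ?_⟩, ?_⟩
    · simp; linarith [hc0 0]
    · have hb : ∀ i, bary !₂[c 1, c 2] i = c i := fun i => by
        fin_cases i
        · simp [bary]; linarith
        · simp [bary]
        · simp [bary]
      rw [s.affineCombination_eq_linear_combination _ _ hs, affMap]
      simp only [hb]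
      simp [hc, ite_smul]
  · rintro _ ⟨x, hx, rfl⟩
    exact affMap_mem_hull K hx

/-- Barycentric coordinates of a point in the hull of a set `C` of vertices, as a function on the
plane supported on `C`, are the same for all triangles with these vertices. -/
theorem exists_weight {C : Set Plane} (hC : C.Finite) {z : Plane} (hz : z ∈ convexHull ℝ C) :
    ∃ w : Plane → ℝ, (∀ y ∉ C, w y = 0) ∧ ∀ K : Affine.Triangle ℝ Plane, C ⊆ range K.points →
      ∀ x, affMap K x = z → ∀ i, bary x i = w (K.points i) := by
  classical
  lift C to Finset Plane using hC
  obtain ⟨w, -, hw1, hwz⟩ := Finset.mem_convexHull'.1 hz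
  refine ⟨fun y => if y ∈ C then w y else 0, fun y hy => if_neg (by simpa using hy),
    fun K hK x hx i => ?_⟩
  have himg : C = Finset.image K.points (Finset.univ.filter fun i => K.points i ∈ C) := by
    ext y
    simp only [Finset.mem_image, Finset.mem_filter, Finset.mem_univ, true_and]
    constructor
    · intro hy
      obtain ⟨i, rfl⟩ := hK hy
      exact ⟨i, hy, rfl⟩
    · rintro ⟨i, hi, rfl⟩; exact hi
  have hsum : ∀ {F : Type} [AddCommMonoid F] (f : Plane → F),
      ∑ y ∈ C, f y = ∑ i, if K.points i ∈ C then f (K.points i) else 0 := by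
    intro F _ f
    conv_lhs => rw [himg]
    rw [Finset.sum_image fun a _ b _ h => K.independent.injective h, Finset.sum_filter]
  refine eq_bary_of_sum_eq K (c := fun i => if K.points i ∈ C then w (K.points i) else 0) ?_ ?_ i
  · rw [← hsum, hw1]
  · rw [hx, ← hwz, hsum]
    exact Finset.sum_congr rfl fun i _ => by split_ifs <;> simp

/-- Summing over all points of the plane removes the triangle and its vertex numbering from the
formula, so that expressions on two elements can be compared. -/
theorem sum_points_eq_finsum (K : Affine.Triangle ℝ Plane) {f : Plane → ℝ}
    (hf : ∀ z ∉ range K.points, f z = 0) : ∑ i, f (K.points i) = ∑ᶠ z, f z := by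
  rw [← finsum_eq_sum_of_fintype, ← finsum_mem_range K.independent.injective]
  refine finsum_congr fun z => ?_
  by_cases h : z ∈ range K.points
  · simp [h]
  · simp [h, hf z h]

/-- Each edge appears as two ordered pairs of vertices; this is why the factor 4 of the edge
functions becomes 2 in the sum over pairs. -/
theorem sum_edges_eq_sum_pairs (f : Fin 3 → Fin 3 → ℝ) (hf : ∀ i j, f i j = f j i) :
    ∑ i : Fin 3, 2 * f (i + 1) (i + 2) = ∑ i, ∑ j, if i = j then 0 else f i j := by
  simp [Fin.sum_univ_three, hf 1 0, hf 2 0, hf 2 1]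
  ring

/-- A Lagrange interpolant in terms of the weights of the vertices of `K`. -/
theorem sum_shape_eq_finsum (p : ℕ) (K : Affine.Triangle ℝ Plane) {w : Plane → ℝ}
    (hw : ∀ z ∉ range K.points, w z = 0) {x : Plane} (hx : ∀ i, bary x i = w (K.points i))
    (f : Plane → ℝ) (G : Plane → ℝ) :
    (∑ i, shape p (.inl i) x * f (K.points i)) + ∑ i, shape p (.inr i) x * G (edgeMid K i) =
      (∑ᶠ z, (if p = 1 then w z else w z * (2 * w z - 1)) * f z) +
      ∑ᶠ z, ∑ᶠ y, if z = y then 0 else if p = 1 then 0 else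
        2 * w z * w y * G (midpoint ℝ z y) := by
  congr 1
  · rw [← sum_points_eq_finsum K (fun z hz => by simp [hw z hz])]
    simp only [shape, hx]
  · rw [← sum_points_eq_finsum K (fun z hz => by simp [hw z hz])]
    simp only [shape, edgeMid]
    have h1 : ∀ i, ∑ᶠ y, (if K.points i = y then 0 else if p = 1 then 0 else
        2 * w (K.points i) * w y * G (midpoint ℝ (K.points i) y)) =
        ∑ j, if i = j then 0 else if p = 1 then 0 else
        2 * bary x i * bary x j * G (midpoint ℝ (K.points i) (K.points j)) := fun i => by
      rw [← sum_points_eq_finsum K (fun z hz => by simp [hw z hz])]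
      simp only [hx, K.independent.injective.eq_iff]
    simp only [h1]
    rw [← sum_edges_eq_sum_pairs (fun i j => if p = 1 then 0 else
        2 * bary x i * bary x j * G (midpoint ℝ (K.points i) (K.points j)))
        (fun i j => by simp only [midpoint_comm (K.points i)]; split_ifs <;> ring)]
    refine Finset.sum_congr rfl fun i _ => ?_
    split_ifs <;> ring

namespace DiskMesh

variable (M : DiskMesh)

open Classical in
/-- The position of the Lagrange node of an edge with midpoint `z`. -/
def edgeNode (z : Plane) : Plane :=
  if M.iso = true ∧ z ∈ frontier (polygon M.cells) then ‖z‖⁻¹ • z else z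

theorem map_vertex (K : Affine.Triangle ℝ Plane) (i : Fin 3) :
    M.map K (refNode (.inl i)) = K.points i := by
  simp only [map, elementMap, affMap, bary_refNode_inl]
  fin_cases i <;> simp [Fin.sum_univ_three]

theorem affMap_edge (K : Affine.Triangle ℝ Plane) (i : Fin 3) :
    affMap K (refNode (.inr i)) = edgeMid K i := by
  simp only [affMap, bary_refNode_inr, edgeMid, midpoint_eq_smul_add]
  fin_cases i <;> simp [Fin.sum_univ_three, add_comm]

/-- The right-hand side depends on the edge only through its midpoint, so two elements sharing an
edge share its node. -/
theorem map_edge (K : Affine.Triangle ℝ Plane) (i : Fin 3) :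
    M.map K (refNode (.inr i)) = M.edgeNode (edgeMid K i) := by
  simp only [map, elementMap, affMap_edge, bary_refNode_inr, edgeNode]
  rcases hM : M.iso with _ | _
  · simp
  · have : (∑ j : Fin 3, (4 * (if j + 1 = i then (0 : ℝ) else 1 / 2) *
        (if j + 2 = i then 0 else 1 / 2)) • bulge M.cells K j) = bulge M.cells K i := by
      fin_cases i <;> simp [Fin.sum_univ_three] <;> norm_num
    simp only [if_true, this]
    by_cases hf : edgeMid K i ∈ frontier (polygon M.cells) <;> simp [bulge, hf]

theorem affMap_eq_of_map_eq {K L : Affine.Triangle ℝ Plane} (hK : K ∈ M.cells) (hL : L ∈ M.cells)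
    {x y : Plane} (hx : x ∈ refTriangle) (hy : y ∈ refTriangle) (h : M.map K x = M.map L y) :
    affMap K x = affMap L y := M.element_inj K hK L hL x hx y hy h

theorem injOn_map {K : Affine.Triangle ℝ Plane} (hK : K ∈ M.cells) :
    InjOn (M.map K) refTriangle := fun _ hx _ hy h =>
  affMap_injective K (M.affMap_eq_of_map_eq hK hK hx hy h)

/-- By `element_inj`, a common point of two curved elements comes from one point of the straight
mesh. Conformity places that point in the hull of the common vertices, where one set of weights
serves both triangles. -/
theorem exists_common_weight {K L : Affine.Triangle ℝ Plane} (hK : K ∈ M.cells) (hL : L ∈ M.cells)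
    {x y : Plane} (hx : x ∈ refTriangle) (hy : y ∈ refTriangle) (h : M.map K x = M.map L y) :
    ∃ w : Plane → ℝ, (∀ z ∉ range K.points ∩ range L.points, w z = 0) ∧
      (∀ i, bary x i = w (K.points i)) ∧ ∀ i, bary y i = w (L.points i) := by
  have ha := M.affMap_eq_of_map_eq hK hL hx hy h
  have hz : affMap K x ∈ convexHull ℝ (range K.points ∩ range L.points) := by
    by_cases hKL : K = L
    · subst hKL
      rw [inter_self]; exact affMap_mem_hull K hx
    · rw [← M.conforming K hK L hL hKL]
      exact ⟨affMap_mem_hull K hx, ha ▸ affMap_mem_hull L hy⟩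
  obtain ⟨w, hw, h⟩ := exists_weight ((finite_range K.points).inter_of_left _) hz
  exact ⟨w, hw, h K inter_subset_left x rfl, h L inter_subset_right y ha.symm⟩

/-- Lagrange interpolants on different elements agree where the elements meet. -/
theorem sum_shape_eq {K L : Affine.Triangle ℝ Plane} (hK : K ∈ M.cells) (hL : L ∈ M.cells)
    {x y : Plane} (hx : x ∈ refTriangle) (hy : y ∈ refTriangle) (h : M.map K x = M.map L y)
    (p : ℕ) (g : Plane → ℝ) :
    ∑ n, shape p n x * g (M.map K (refNode n)) = ∑ n, shape p n y * g (M.map L (refNode n)) := by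
  obtain ⟨w, hw, hwK, hwL⟩ := M.exists_common_weight hK hL hx hy h
  simp only [Fintype.sum_sum_type, map_vertex, map_edge]
  rw [sum_shape_eq_finsum p K (fun z hz => hw z fun h => hz h.1) hwK g fun z => g (M.edgeNode z),
    sum_shape_eq_finsum p L (fun z hz => hw z fun h => hz h.2) hwL g fun z => g (M.edgeNode z)]

/-- Interior points have positive weight at every vertex, whereas common weights live on common
vertices. An intersection would thus force equal vertex sets, contradicting `injOn`. -/
theorem disjoint_image {K L : Affine.Triangle ℝ Plane} (hK : K ∈ M.cells) (hL : L ∈ M.cells)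
    (hKL : K ≠ L) : Disjoint (M.map K '' openTriangle) (M.map L '' openTriangle) := by
  rw [Set.disjoint_left]
  rintro _ ⟨x, hx, rfl⟩ ⟨y, hy, hxy⟩
  obtain ⟨w, hw, hwK, hwL⟩ := M.exists_common_weight hK hL (openTriangle_subset hx)
    (openTriangle_subset hy) hxy.symm
  refine hKL (M.injOn hK hL (Subset.antisymm ?_ ?_))
  · rintro _ ⟨i, rfl⟩
    by_contra hi
    have := bary_pos hx i
    rw [hwK, hw _ fun h => hi h.2] at this
    exact lt_irrefl _ this
  · rintro _ ⟨i, rfl⟩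
    by_contra hi
    have := bary_pos hy i
    rw [hwL, hw _ fun h => hi h.1] at this
    exact lt_irrefl _ this

/-! ### Continuity and interpolation -/

theorem continuous_affMap (K : Affine.Triangle ℝ Plane) : Continuous (affMap K) :=
  continuous_finsetSum _ fun i _ => (continuous_bary i).smul continuous_const

theorem continuous_map (K : Affine.Triangle ℝ Plane) : Continuous (M.map K) := by
  refine (continuous_affMap K).add ?_
  split_ifs
  · exact continuous_finsetSum _ fun i _ => ((continuous_const.mul (continuous_bary _)).mul
      (continuous_bary _)).smul continuous_const
  · exact continuous_const

theorem map_mem_domain {K : Affine.Triangle ℝ Plane} (hK : K ∈ M.cells) {x : Plane}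
    (hx : x ∈ refTriangle) : M.map K x ∈ M.domain :=
  mem_biUnion (show K ∈ (M.cells : Set _) from hK) (mem_image_of_mem _ hx)

theorem exists_of_mem_domain {z : Plane} (hz : z ∈ M.domain) :
    ∃ K ∈ M.cells, ∃ x ∈ refTriangle, M.map K x = z := by
  simpa [domain] using hz

theorem isCompact_domain : IsCompact M.domain :=
  M.cells.isCompact_biUnion fun K _ => isCompact_refTriangle.image (M.continuous_map K)

theorem domain_subset : M.domain ⊆ closedBall 0 1 :=
  iUnion₂_subset fun K hK => M.element_subset K hK

/-- On the compact reference triangle an element map is a closed surjection onto its image, hence a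
quotient map, so continuity can be tested in the reference variable. The finitely many closed images
then glue. -/
theorem continuousOn_domain {F : Type*} [TopologicalSpace F] {v : Plane → F}
    (hv : ∀ K ∈ M.cells, ContinuousOn (fun x => v (M.map K x)) refTriangle) :
    ContinuousOn v M.domain := by
  have hK : ∀ K ∈ M.cells, ContinuousOn v (M.map K '' refTriangle) := by
    intro K hK
    have : CompactSpace refTriangle := isCompact_iff_compactSpace.1 isCompact_refTriangle
    let F : refTriangle → M.map K '' refTriangle := fun x => ⟨M.map K x, mem_image_of_mem _ x.2⟩
    have hF : Continuous F := by
      have := M.continuous_map K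
      exact Continuous.subtype_mk (by fun_prop) _
    have hs : Function.Surjective F := by
      rintro ⟨_, x, hx, rfl⟩
      exact ⟨⟨x, hx⟩, rfl⟩
    have hq := hF.isClosedMap.isQuotientMap hF hs
    rw [continuousOn_iff_continuous_domRestrict, hq.continuous_iff]
    exact continuousOn_iff_continuous_domRestrict.1 (hv K hK)
  have hfin : ∀ s : Finset (Affine.Triangle ℝ Plane), s ⊆ M.cells →
      ContinuousOn v (⋃ K ∈ s, M.map K '' refTriangle) := by
    classical
    intro s
    induction s using Finset.induction_on with
    | empty => simp
    | insert K s _ ih =>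
      intro hs
      rw [Finset.set_biUnion_insert]
      refine (hK K (hs (Finset.mem_insert_self K s))).union_of_isClosed
        (ih fun L hL => hs (Finset.mem_insert_of_mem hL))
        (isCompact_refTriangle.image (M.continuous_map K)).isClosed
        (s.isCompact_biUnion fun L _ => isCompact_refTriangle.image (M.continuous_map L)).isClosed
  exact hfin _ subset_rfl

/-- Lagrange interpolation of degree `p` of an arbitrary function. -/
theorem exists_interpolant {p : ℕ} (hp : p = 1 ∨ p = 2) (g : Plane → ℝ) :
    ∃ v ∈ M.V p, ∀ K ∈ M.cells, ∀ x ∈ refTriangle,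
      v (M.map K x) = ∑ n, shape p n x * g (M.map K (refNode n)) := by
  classical
  -- The value uses an arbitrary element and reference point over `z`; `sum_shape_eq` shows that the
  -- choice does not matter.
  let v : Plane → ℝ := fun z =>
    if h : ∃ y : Affine.Triangle ℝ Plane × Plane, y.1 ∈ M.cells ∧ y.2 ∈ refTriangle ∧
        M.map y.1 y.2 = z then
      ∑ n, shape p n h.choose.2 * g (M.map h.choose.1 (refNode n)) else 0
  have hv : ∀ K ∈ M.cells, ∀ x ∈ refTriangle,
      v (M.map K x) = ∑ n, shape p n x * g (M.map K (refNode n)) := by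
    intro K hK x hx
    have h : ∃ y : Affine.Triangle ℝ Plane × Plane, y.1 ∈ M.cells ∧ y.2 ∈ refTriangle ∧
        M.map y.1 y.2 = M.map K x := ⟨(K, x), hK, hx, rfl⟩
    simp only [v, dif_pos h]
    exact M.sum_shape_eq h.choose_spec.1 hK h.choose_spec.2.1 hx h.choose_spec.2.2 p g
  refine ⟨v, ⟨M.continuousOn_domain fun K hK => ?_, fun z hz => dif_neg ?_, fun K hK => ?_⟩, hv⟩
  · refine ContinuousOn.congr (Continuous.continuousOn ?_) fun x hx => hv K hK x hx
    exact continuous_finsetSum _ fun n _ => (continuous_shape p n).mul continuous_const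
  · rintro ⟨⟨K, x⟩, hK, hx, rfl⟩
    exact hz (M.map_mem_domain hK hx)
  · choose q hq hq' using fun n => exists_polynomial_shape hp n
    refine ⟨∑ n, .C (g (M.map K (refNode n))) * q n, ?_, fun x hx => ?_⟩
    · refine MvPolynomial.totalDegree_finsetSum_le fun n _ => ?_
      refine (MvPolynomial.totalDegree_mul _ _).trans ?_
      simpa using hq n
    · rw [hv K hK x hx]
      simp [hq', mul_comm]

end DiskMesh

/-! ### The Jacobian of the element maps -/

/-- The determinant of two vectors in the plane. -/
def cross (a b : Plane) : ℝ := a 0 * b 1 - a 1 * b 0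

theorem abs_cross_le (a b : Plane) : |cross a b| ≤ ‖a‖ * ‖b‖ := by
  refine abs_le_of_sq_le_sq ?_ (by positivity)
  rw [mul_pow, EuclideanSpace.norm_sq_eq, EuclideanSpace.norm_sq_eq]
  simp only [Fin.sum_univ_two, Real.norm_eq_abs, sq_abs, cross]
  -- Lagrange's identity: `|a|²|b|² - cross(a, b)² = (a · b)²`.
  nlinarith [sq_nonneg (a 0 * b 0 + a 1 * b 1)]

theorem det_eq_cross (A : Plane →L[ℝ] Plane) :
    A.det = cross (A (EuclideanSpace.single 0 1)) (A (EuclideanSpace.single 1 1)) := by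
  rw [ContinuousLinearMap.det, ← LinearMap.det_toMatrix (EuclideanSpace.basisFun (Fin 2) ℝ).toBasis,
    Matrix.det_fin_two]
  simp [LinearMap.toMatrix_apply, cross]
  ring

/-- The differentials of the barycentric coordinates. -/
def dbary : Fin 3 → Plane →L[ℝ] ℝ :=
  ![-EuclideanSpace.proj 0 - EuclideanSpace.proj 1, EuclideanSpace.proj 0, EuclideanSpace.proj 1]

theorem hasStrictFDerivAt_bary (i : Fin 3) (x : Plane) :
    HasStrictFDerivAt (fun y => bary y i) (dbary i) x := by
  have h : ∀ j : Fin 2, HasStrictFDerivAt (fun y : Plane => y j)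
      (EuclideanSpace.proj j : Plane →L[ℝ] ℝ) x := fun j =>
    (EuclideanSpace.proj j : Plane →L[ℝ] ℝ).hasStrictFDerivAt
  fin_cases i
  · change HasStrictFDerivAt (fun y : Plane => 1 - y 0 - y 1)
      (-EuclideanSpace.proj 0 - EuclideanSpace.proj 1) x
    exact ((h 0).const_sub 1).sub (h 1)
  · exact h 0
  · exact h 1

theorem abs_dbary_le (i : Fin 3) (j : Fin 2) : |dbary i (EuclideanSpace.single j 1)| ≤ 1 := by
  fin_cases i <;> fin_cases j <;> simp [dbary]

theorem abs_quad_le_one {x : Plane} (hx : x ∈ refTriangle) (i : Fin 3) :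
    |4 * bary x (i + 1) * bary x (i + 2)| ≤ 1 := by
  simpa [shape] using abs_shape_le_one 2 (.inr i) hx

/-- The edge vectors of `K` at its first vertex. -/
def edgeVec (K : Affine.Triangle ℝ Plane) (j : Fin 2) : Plane := K.points j.succ - K.points 0

theorem affMap_sub (K : Affine.Triangle ℝ Plane) (x y : Plane) :
    affMap K x - affMap K y = (x 0 - y 0) • edgeVec K 0 + (x 1 - y 1) • edgeVec K 1 := by
  simp only [affMap, Fin.sum_univ_three, bary_zero, bary_one, bary_two, edgeVec, Fin.succ_zero_eq_one,
    Fin.succ_one_eq_two]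
  module

theorem isBounded_hull (K : Affine.Triangle ℝ Plane) : Bornology.IsBounded (hull K) :=
  isBounded_convexHull.2 (finite_range _).isBounded

theorem abs_sub_le_one {x y : Plane} (hx : x ∈ refTriangle) (hy : y ∈ refTriangle) (j : Fin 2) :
    |x j - y j| ≤ 1 := by
  obtain ⟨h0, h1, h2⟩ := hx
  obtain ⟨k0, k1, k2⟩ := hy
  rw [abs_le]
  fin_cases j
  · change -1 ≤ x 0 - y 0 ∧ x 0 - y 0 ≤ 1; constructor <;> linarith
  · change -1 ≤ x 1 - y 1 ∧ x 1 - y 1 ≤ 1; constructor <;> linarith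

theorem edgeVec_ne_zero (K : Affine.Triangle ℝ Plane) (j : Fin 2) : edgeVec K j ≠ 0 :=
  sub_ne_zero.2 fun h => Fin.succ_ne_zero j (K.independent.injective h)

/-- A triangle that contains a disk of radius `r` has height at least `2 r`. -/
theorem height_ge {K : Affine.Triangle ℝ Plane} {c : Plane} {r : ℝ} (hr : 0 ≤ r)
    (h : closedBall c r ⊆ hull K) (j : Fin 2) :
    2 * r * ‖edgeVec K j‖ ≤ |cross (edgeVec K 0) (edgeVec K 1)| := by
  set E := edgeVec K j with hE
  have hEn : 0 < ‖E‖ := norm_pos_iff.2 (edgeVec_ne_zero K j)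
  have hsq : ‖E‖ ^ 2 = E 0 ^ 2 + E 1 ^ 2 := by
    rw [EuclideanSpace.norm_sq_eq]; simp [Fin.sum_univ_two]
  -- `n` is the edge turned by a right angle, and `c ± w` are the ends of the diameter of the disk
  -- in this direction. Crossing the diameter with `E` gives `2 r |E|`, and also the area form times
  -- a difference of reference coordinates, which is at most 1 in modulus.
  set n : Plane := !₂[-E 1, E 0] with hn
  have hnn : ‖n‖ = ‖E‖ := by
    rw [EuclideanSpace.norm_eq, EuclideanSpace.norm_eq]
    simp [hn, Fin.sum_univ_two, add_comm]
  set w : Plane := (r / ‖E‖) • n with hw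
  have hwn : ‖w‖ ≤ r := by
    rw [hw, norm_smul, hnn, Real.norm_of_nonneg (by positivity), div_mul_cancel₀ _ hEn.ne']
  have h1 : c + w ∈ hull K := h (by simpa using hwn)
  have h2 : c - w ∈ hull K := h (by simpa [sub_eq_add_neg] using hwn)
  rw [hull_eq_image] at h1 h2
  obtain ⟨x, hx, hxw⟩ := h1
  obtain ⟨y, hy, hyw⟩ := h2
  have hd : (2 : ℝ) • w = (x 0 - y 0) • edgeVec K 0 + (x 1 - y 1) • edgeVec K 1 := by
    rw [← affMap_sub, hxw, hyw]; module
  have hc1 : cross E ((2 : ℝ) • w) = 2 * r * ‖E‖ := by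
    have : cross E ((2 : ℝ) • w) = 2 * (r / ‖E‖) * (E 0 ^ 2 + E 1 ^ 2) := by
      simp [cross, hw, hn]; ring
    rw [this, ← hsq]; field_simp
  rw [← hc1, hd]
  set D := cross (edgeVec K 0) (edgeVec K 1) with hD
  have hx0 := abs_sub_le_one hx hy 0
  have hx1 := abs_sub_le_one hx hy 1
  have key : ∀ s : ℝ, |s| ≤ 1 → s * D ≤ |D| := fun s hs => by
    refine (le_abs_self _).trans ?_
    rw [abs_mul]
    exact mul_le_of_le_one_left (abs_nonneg _) hs
  have hj : j = 0 ∨ j = 1 := by omega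
  rcases hj with hj | hj
  · have : cross E ((x 0 - y 0) • edgeVec K 0 + (x 1 - y 1) • edgeVec K 1) = (x 1 - y 1) * D := by
      rw [hE, hD, hj]; simp [cross]; ring
    rw [this]; exact key _ hx1
  · have : cross E ((x 0 - y 0) • edgeVec K 0 + (x 1 - y 1) • edgeVec K 1) = -(x 0 - y 0) * D := by
      rw [hE, hD, hj]; simp [cross]; ring
    rw [this]; exact key _ (by rwa [abs_neg])

/-- The height bound for one edge and `|cross| ≤ ‖E₀‖ ‖E₁‖` show `‖E₀‖ ≥ 2 r`; the height bound for
`E₀` then gives the claim. -/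
theorem sq_le_cross {K : Affine.Triangle ℝ Plane} {c : Plane} {r : ℝ} (hr : 0 ≤ r)
    (h : closedBall c r ⊆ hull K) :
    4 * r ^ 2 ≤ |cross (edgeVec K 0) (edgeVec K 1)| := by
  have h0 := height_ge hr h 0
  have h1 := height_ge hr h 1
  have hle := abs_cross_le (edgeVec K 0) (edgeVec K 1)
  have hp : 0 < ‖edgeVec K 1‖ := norm_pos_iff.2 (edgeVec_ne_zero K 1)
  have h2 : 2 * r ≤ ‖edgeVec K 0‖ := le_of_mul_le_mul_right (h1.trans hle) hp
  nlinarith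

theorem abs_cross_add_sub_le (a b A B : Plane) :
    |cross (a + A) (b + B) - cross a b| ≤ ‖a‖ * ‖B‖ + ‖A‖ * ‖b‖ + ‖A‖ * ‖B‖ := by
  have : cross (a + A) (b + B) - cross a b = cross a B + cross A b + cross A B := by
    simp [cross]; ring
  rw [this]
  exact (abs_add_three _ _ _).trans (add_le_add (add_le_add (abs_cross_le _ _) (abs_cross_le _ _))
    (abs_cross_le _ _))

namespace DiskMesh

variable (M : DiskMesh)

/-- The displacement of the edge midpoints. -/
def shift (K : Affine.Triangle ℝ Plane) (i : Fin 3) : Plane :=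
  if M.iso then bulge M.cells K i else 0

theorem map_eq (K : Affine.Triangle ℝ Plane) (x : Plane) :
    M.map K x = affMap K x + ∑ i, (4 * bary x (i + 1) * bary x (i + 2)) • M.shift K i := by
  rcases hM : M.iso with _ | _ <;> simp [map, elementMap, shift, hM]

theorem dist_le_h {K : Affine.Triangle ℝ Plane} (hK : K ∈ M.cells) {a b : Plane} (ha : a ∈ hull K)
    (hb : b ∈ hull K) : dist a b ≤ M.h :=
  (dist_le_diam_of_mem (isBounded_hull K) ha hb).trans
    (Finset.le_sup' (fun K => diam (hull K)) hK)

theorem h_pos : 0 < M.h := by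
  obtain ⟨K, hK⟩ := M.nonempty
  have h := M.dist_le_h hK (a := K.points 1) (b := K.points 0)
    (subset_convexHull ℝ _ (mem_range_self _)) (subset_convexHull ℝ _ (mem_range_self _))
  refine (dist_pos.2 fun h => ?_).trans_le h
  exact absurd (K.independent.injective h) (by decide)

theorem norm_edgeVec_le {K : Affine.Triangle ℝ Plane} (hK : K ∈ M.cells) (j : Fin 2) :
    ‖edgeVec K j‖ ≤ M.h := by
  rw [edgeVec, ← dist_eq_norm]
  exact M.dist_le_h hK (subset_convexHull ℝ _ (mem_range_self _))
    (subset_convexHull ℝ _ (mem_range_self _))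

theorem convex_polygon : Convex ℝ (polygon M.cells) := by
  rw [M.inscribed]; exact convex_convexHull ℝ _

theorem hull_subset_polygon {K : Affine.Triangle ℝ Plane} (hK : K ∈ M.cells) :
    hull K ⊆ polygon M.cells := subset_biUnion_of_mem (u := hull) (show K ∈ (M.cells : Set _) from hK)

/-- In a convex set the midpoint between an interior point and a point of the closure is interior. A
boundary midpoint therefore forces its endpoints onto the boundary, hence onto the circle. -/
theorem norm_vertex_eq_one {K : Affine.Triangle ℝ Plane} (hK : K ∈ M.cells) {i j : Fin 3}
    (h : midpoint ℝ (K.points i) (K.points j) ∈ frontier (polygon M.cells)) :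
    ‖K.points i‖ = 1 := by
  have hmem : ∀ k, K.points k ∈ closure (polygon M.cells) := fun k =>
    subset_closure (M.hull_subset_polygon hK (subset_convexHull ℝ _ (mem_range_self k)))
  refine M.boundary_vertex K hK i ⟨hmem i, fun hint => h.2 ?_⟩
  rw [midpoint_eq_smul_add, smul_add]
  exact M.convex_polygon.combo_interior_closure_mem_interior hint (hmem j) (by norm_num)
    (by norm_num) (by norm_num)

/-- For a chord of length `ℓ` of the unit circle, the parallelogram law gives `|m|² = 1 - ℓ²/4` for
the midpoint, so the radial displacement is `1 - |m| ≤ 1 - |m|² = ℓ²/4`. -/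
theorem norm_shift_le {K : Affine.Triangle ℝ Plane} (hK : K ∈ M.cells) (i : Fin 3) :
    ‖M.shift K i‖ ≤ M.h ^ 2 / 4 := by
  have h0 : (0 : ℝ) ≤ M.h ^ 2 / 4 := by positivity
  unfold shift bulge
  split_ifs with h1 h2
  · set m := edgeMid K i with hm
    have ha := M.norm_vertex_eq_one hK h2
    have hb : ‖K.points (i + 2)‖ = 1 := by
      refine M.norm_vertex_eq_one hK (i := i + 2) (j := i + 1) ?_
      rw [midpoint_comm]; exact h2
    have hab : ‖K.points (i + 1) - K.points (i + 2)‖ ≤ M.h := by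
      rw [← dist_eq_norm]
      exact M.dist_le_h hK (subset_convexHull ℝ _ (mem_range_self _))
        (subset_convexHull ℝ _ (mem_range_self _))
    have hmn : ‖m‖ ^ 2 = 1 - ‖K.points (i + 1) - K.points (i + 2)‖ ^ 2 / 4 := by
      have hp := parallelogram_law_with_norm ℝ (K.points (i + 1)) (K.points (i + 2))
      rw [hm, edgeMid, midpoint_eq_smul_add, norm_smul, mul_pow]
      rw [ha, hb] at hp
      norm_num at hp ⊢
      nlinarith
    -- If the chord is a diameter, the convention `0⁻¹ = 0` makes the displacement zero.
    rcases eq_or_ne m 0 with hm0 | hm0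
    · rw [hm0]; simpa using h0
    · have hmp : 0 < ‖m‖ := norm_pos_iff.2 hm0
      have hm1 : ‖m‖ ≤ 1 := by
        refine (pow_le_one_iff_of_nonneg (norm_nonneg _) two_ne_zero).1 ?_
        rw [hmn]; nlinarith [sq_nonneg ‖K.points (i + 1) - K.points (i + 2)‖]
      have : ‖m‖⁻¹ • m - m = (‖m‖⁻¹ - 1) • m := by module
      rw [this, norm_smul, Real.norm_of_nonneg (by rw [sub_nonneg]; exact (one_le_inv₀ hmp).2 hm1),
        sub_mul, inv_mul_cancel₀ hmp.ne', one_mul]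
      nlinarith [norm_nonneg (K.points (i + 1) - K.points (i + 2))]
  · simpa using h0
  · simpa using h0

/-- Elements have diameter at most `3 h`. -/
theorem dist_map_le {K : Affine.Triangle ℝ Plane} (hK : K ∈ M.cells) (h1 : M.h ≤ 1) {x y : Plane}
    (hx : x ∈ refTriangle) (hy : y ∈ refTriangle) : dist (M.map K x) (M.map K y) ≤ 3 * M.h := by
  -- Three displacements of size at most `h²/4` add up to at most `h`. The total `3 h` consists of
  -- the affine part and one such correction at each end.
  have hb : ∀ z ∈ refTriangle,
      ‖∑ i, (4 * bary z (i + 1) * bary z (i + 2)) • M.shift K i‖ ≤ M.h := fun z hz => by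
    refine (norm_sum_le_of_le _ (n := fun _ => M.h ^ 2 / 4) fun i _ => ?_).trans ?_
    · rw [norm_smul]
      exact (mul_le_of_le_one_left (norm_nonneg _) (abs_quad_le_one hz i)).trans
        (M.norm_shift_le hK i)
    · simp; nlinarith [M.h_pos]
  rw [map_eq, map_eq]
  refine (dist_add_add_le _ _ _ _).trans ?_
  have h2 := M.dist_le_h hK (affMap_mem_hull K hx) (affMap_mem_hull K hy)
  have h3 := dist_le_norm_add_norm (∑ i, (4 * bary x (i + 1) * bary x (i + 2)) • M.shift K i)
    (∑ i, (4 * bary y (i + 1) * bary y (i + 2)) • M.shift K i)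
  linarith [hb x hx, hb y hy]

/-- The differential of the isoparametric correction. -/
def corrDeriv (K : Affine.Triangle ℝ Plane) (x : Plane) : Plane →L[ℝ] Plane :=
  ∑ i, ((4 * bary x (i + 1)) • dbary (i + 2) + (4 * bary x (i + 2)) • dbary (i + 1)).smulRight
    (M.shift K i)

/-- The differential of the element map. -/
def mapDeriv (K : Affine.Triangle ℝ Plane) (x : Plane) : Plane →L[ℝ] Plane :=
  (∑ i, (dbary i).smulRight (K.points i)) + M.corrDeriv K x

theorem hasStrictFDerivAt_map (K : Affine.Triangle ℝ Plane) (x : Plane) :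
    HasStrictFDerivAt (M.map K) (M.mapDeriv K x) x := by
  have h : HasStrictFDerivAt (fun x => affMap K x +
      ∑ i, (4 * bary x (i + 1) * bary x (i + 2)) • M.shift K i) (M.mapDeriv K x) x := by
    refine HasStrictFDerivAt.add (HasStrictFDerivAt.fun_sum fun i _ =>
      (hasStrictFDerivAt_bary i x).smul_const _) (HasStrictFDerivAt.fun_sum fun i _ =>
      HasStrictFDerivAt.smul_const ?_ _)
    refine (((hasStrictFDerivAt_bary (i + 1) x).const_mul 4).mul
      (hasStrictFDerivAt_bary (i + 2) x)).congr_fderiv ?_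
    rw [smul_smul, mul_comm (bary x (i + 2))]
  rwa [← show M.map K = _ from funext (M.map_eq K)] at h

theorem continuous_mapDeriv (K : Affine.Triangle ℝ Plane) : Continuous (M.mapDeriv K) := by
  have hb := continuous_bary
  refine continuous_const.add (continuous_finsetSum _ fun i _ => ?_)
  have h : Continuous fun x => (4 * bary x (i + 1)) • dbary (i + 2) +
      (4 * bary x (i + 2)) • dbary (i + 1) := by fun_prop
  exact (ContinuousLinearMap.smulRightL ℝ Plane Plane).continuous₂.comp (h.prodMk continuous_const)

theorem mapDeriv_single (K : Affine.Triangle ℝ Plane) (x : Plane) (j : Fin 2) :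
    M.mapDeriv K x (EuclideanSpace.single j 1) =
      edgeVec K j + M.corrDeriv K x (EuclideanSpace.single j 1) := by
  have : (∑ i, (dbary i).smulRight (K.points i)) (EuclideanSpace.single j 1) = edgeVec K j := by
    fin_cases j <;> simp [dbary, edgeVec, Fin.sum_univ_three] <;> abel
  rw [mapDeriv, add_apply, this]

/-- Each of the three terms has a scalar factor at most `4 + 4` and a displacement at most `h²/4`.
-/
theorem norm_corrDeriv_le {K : Affine.Triangle ℝ Plane} (hK : K ∈ M.cells) {x : Plane}
    (hx : x ∈ refTriangle) (j : Fin 2) :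
    ‖M.corrDeriv K x (EuclideanSpace.single j 1)‖ ≤ 6 * M.h ^ 2 := by
  rw [corrDeriv, sum_apply]
  refine (norm_sum_le_of_le _ (n := fun _ => 2 * M.h ^ 2) fun i _ => ?_).trans (by simp; linarith)
  rw [ContinuousLinearMap.smulRight_apply, norm_smul]
  have h1 : ‖((4 * bary x (i + 1)) • dbary (i + 2) + (4 * bary x (i + 2)) • dbary (i + 1))
      (EuclideanSpace.single j 1)‖ ≤ 8 := by
    simp only [add_apply, smul_apply, smul_eq_mul]
    have key : ∀ t d : ℝ, 0 ≤ t → t ≤ 1 → |d| ≤ 1 → ‖4 * t * d‖ ≤ 4 := fun t d h0 h1 hd => by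
      rw [Real.norm_eq_abs, abs_mul, abs_of_nonneg (by positivity)]
      nlinarith [abs_nonneg d]
    refine (norm_add_le _ _).trans ((add_le_add
      (key _ _ (bary_nonneg hx _) (bary_le_one hx _) (abs_dbary_le _ j))
      (key _ _ (bary_nonneg hx _) (bary_le_one hx _) (abs_dbary_le _ j))).trans (by norm_num))
  have h2 := M.norm_shift_le hK i
  nlinarith [norm_nonneg (M.shift K i), norm_nonneg (((4 * bary x (i + 1)) • dbary (i + 2) +
    (4 * bary x (i + 2)) • dbary (i + 1)) (EuclideanSpace.single j 1))]

/-- The Jacobian determinants of the element maps are bounded below, and comparable on each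
element. -/
def IsRegular : Prop :=
  ∀ K ∈ M.cells, ∃ D > (0 : ℝ), ∀ x ∈ refTriangle,
    D / 2 ≤ |(M.mapDeriv K x).det| ∧ |(M.mapDeriv K x).det| ≤ 3 / 2 * D

/-- `D` is the Jacobian of the affine part. The triangle contains a disk of radius at least `h/σ²`,
so `D ≥ 4 h²/σ⁴`, while the curved correction changes the determinant by at most `12 h³ + 36 h⁴ ≤ 48
h³`. This is at most `D/2` as soon as `24 σ⁴ h ≤ 1`. -/
theorem IsQuasiUniform.isRegular {M : DiskMesh} {σ : ℝ} (hσ : 0 < σ) (hM : M.IsQuasiUniform σ)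
    (h1 : M.h ≤ 1) (h2 : M.h ≤ 1 / (24 * σ ^ 4)) : M.IsRegular := by
  intro K hK
  obtain ⟨⟨c, hc⟩, hd⟩ := hM K hK
  have hh := M.h_pos
  have hr : M.h / σ ^ 2 ≤ diam (hull K) / σ := by
    rw [div_le_div_iff₀ (by positivity) hσ]; nlinarith
  have hD := sq_le_cross (div_nonneg diam_nonneg hσ.le) hc
  set D := |cross (edgeVec K 0) (edgeVec K 1)| with hDdef
  have hD2 : 4 * (M.h / σ ^ 2) ^ 2 ≤ D := by
    refine le_trans ?_ hD
    have : 0 ≤ M.h / σ ^ 2 := by positivity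
    gcongr
  have hpos : 0 < D := lt_of_lt_of_le (by positivity) hD2
  have hsmall : 48 * M.h ^ 3 ≤ D / 2 := by
    have h3 : 24 * σ ^ 4 * M.h ≤ 1 := by
      rw [le_div_iff₀ (by positivity)] at h2; linarith
    have h4 : 48 * M.h ^ 3 ≤ 2 * (M.h / σ ^ 2) ^ 2 := by
      rw [div_pow, mul_div_assoc', le_div_iff₀ (by positivity)]
      nlinarith [sq_nonneg M.h]
    linarith
  refine ⟨D, hpos, fun x hx => ?_⟩
  have hp := abs_cross_add_sub_le (edgeVec K 0) (edgeVec K 1)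
    (M.corrDeriv K x (EuclideanSpace.single 0 1)) (M.corrDeriv K x (EuclideanSpace.single 1 1))
  rw [← mapDeriv_single, ← mapDeriv_single, ← det_eq_cross] at hp
  have e0 := M.norm_edgeVec_le hK 0
  have e1 := M.norm_edgeVec_le hK 1
  have c0 := M.norm_corrDeriv_le hK hx 0
  have c1 := M.norm_corrDeriv_le hK hx 1
  have hb : ‖edgeVec K 0‖ * ‖M.corrDeriv K x (EuclideanSpace.single 1 1)‖ +
      ‖M.corrDeriv K x (EuclideanSpace.single 0 1)‖ * ‖edgeVec K 1‖ +
      ‖M.corrDeriv K x (EuclideanSpace.single 0 1)‖ *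
      ‖M.corrDeriv K x (EuclideanSpace.single 1 1)‖ ≤ 48 * M.h ^ 3 := by
    have : ‖edgeVec K 0‖ * ‖M.corrDeriv K x (EuclideanSpace.single 1 1)‖ +
      ‖M.corrDeriv K x (EuclideanSpace.single 0 1)‖ * ‖edgeVec K 1‖ +
      ‖M.corrDeriv K x (EuclideanSpace.single 0 1)‖ *
      ‖M.corrDeriv K x (EuclideanSpace.single 1 1)‖ ≤
      M.h * (6 * M.h ^ 2) + 6 * M.h ^ 2 * M.h + 6 * M.h ^ 2 * (6 * M.h ^ 2) := by gcongr
    refine this.trans ?_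
    have : M.h ^ 4 ≤ M.h ^ 3 := pow_le_pow_of_le_one hh.le h1 (by norm_num)
    nlinarith
  have h5 := abs_sub_abs_le_abs_sub (M.mapDeriv K x).det (cross (edgeVec K 0) (edgeVec K 1))
  have h6 := abs_sub_abs_le_abs_sub (cross (edgeVec K 0) (edgeVec K 1)) (M.mapDeriv K x).det
  rw [abs_sub_comm (cross _ _)] at h6
  constructor <;> linarith

/-! ### Integration over the elements -/

theorem measurableSet_image {K : Affine.Triangle ℝ Plane} (hK : K ∈ M.cells) :
    MeasurableSet (M.map K '' openTriangle) :=
  isOpen_openTriangle.measurableSet.image_of_continuousOn_injOn (M.continuous_map K).continuousOn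
    ((M.injOn_map hK).mono openTriangle_subset)

theorem image_subset_domain {K : Affine.Triangle ℝ Plane} (hK : K ∈ M.cells) :
    M.map K '' openTriangle ⊆ M.domain := by
  rintro _ ⟨x, hx, rfl⟩
  exact M.map_mem_domain hK (openTriangle_subset hx)

/-- Differentiable maps send the null boundary of the reference triangle to null sets. The open
images are disjoint, so integrals over `D_h` split into elements. -/
theorem domain_ae_eq : M.domain =ᵐ[volume] ⋃ K ∈ M.cells, M.map K '' openTriangle := by
  refine EventuallyLE.antisymm ?_ (Eventually.of_forall fun z hz => ?_)
  · rw [ae_le_set]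
    refine measure_mono_null (t := ⋃ K ∈ M.cells, M.map K '' (refTriangle \ openTriangle)) ?_ ?_
    · rintro z ⟨hz, hz'⟩
      obtain ⟨K, hK, x, hx, rfl⟩ := M.exists_of_mem_domain hz
      refine mem_biUnion (show K ∈ (M.cells : Set _) from hK) (mem_image_of_mem _ ⟨hx, fun h => hz' ?_⟩)
      exact mem_biUnion (show K ∈ (M.cells : Set _) from hK) (mem_image_of_mem _ h)
    · refine (measure_biUnion_null_iff M.cells.countable_toSet).2 fun K hK => ?_
      exact addHaar_image_eq_zero_of_differentiableOn_of_addHaar_eq_zero volume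
        (fun x _ => (M.hasStrictFDerivAt_map K x).hasFDerivAt.differentiableAt.differentiableWithinAt)
        volume_refTriangle_diff
  · exact (iUnion₂_subset fun K hK => M.image_subset_domain hK : (⋃ K ∈ M.cells, _) ⊆ M.domain) hz

theorem integral_domain {f : Plane → ℝ} (hf : IntegrableOn f M.domain) :
    ∫ z in M.domain, f z =
      ∑ K ∈ M.cells, ∫ x in openTriangle, |(M.mapDeriv K x).det| * f (M.map K x) := by
  rw [setIntegral_congr_set M.domain_ae_eq,
    integral_biUnion_finset M.cells (fun K hK => M.measurableSet_image hK)
      (fun K hK L hL hKL => M.disjoint_image hK hL hKL)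
      (fun K hK => hf.mono_set (M.image_subset_domain hK))]
  refine Finset.sum_congr rfl fun K hK => ?_
  rw [integral_image_eq_integral_abs_det_fderiv_smul volume isOpen_openTriangle.measurableSet
    (fun x _ => (M.hasStrictFDerivAt_map K x).hasFDerivAt.hasFDerivWithinAt)
    ((M.injOn_map hK).mono openTriangle_subset)]
  rfl

theorem ae_domain : ∀ᵐ z ∂volume.restrict M.domain, ∃ K ∈ M.cells, ∃ x ∈ openTriangle,
    M.map K x = z := by
  rw [Measure.restrict_congr_set M.domain_ae_eq]
  have hm : MeasurableSet (⋃ K ∈ M.cells, M.map K '' openTriangle) :=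
    M.cells.measurableSet_biUnion fun K hK => M.measurableSet_image hK
  filter_upwards [ae_restrict_mem hm] with z hz
  simpa using hz

end DiskMesh

namespace DiskMesh

variable (M : DiskMesh)

/-! ### The finite element spaces as vector spaces -/

/-- `V_h^p` as a subspace. -/
def VSub (p : ℕ) : Submodule ℝ (Plane → ℝ) where
  carrier := M.V p
  zero_mem' := ⟨continuousOn_const, fun _ _ => rfl, fun _ _ => ⟨0, by simp, by simp⟩⟩
  add_mem' := by
    rintro v w ⟨hv, hv0, hvp⟩ ⟨hw, hw0, hwp⟩
    refine ⟨hv.add hw, fun x hx => by simp [hv0 x hx, hw0 x hx], fun K hK => ?_⟩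
    obtain ⟨q, hq, hq'⟩ := hvp K hK
    obtain ⟨r, hr, hr'⟩ := hwp K hK
    exact ⟨q + r, (MvPolynomial.totalDegree_add _ _).trans (max_le hq hr),
      fun x hx => by simp [hq' x hx, hr' x hx]⟩
  smul_mem' := by
    rintro c v ⟨hv, hv0, hvp⟩
    refine ⟨hv.const_smul c, fun x hx => by simp [hv0 x hx], fun K hK => ?_⟩
    obtain ⟨q, hq, hq'⟩ := hvp K hK
    exact ⟨c • q, (MvPolynomial.totalDegree_smul_le _ _).trans hq,
      fun x hx => by simp [hq' x hx]⟩

/-- `V_{h,0}^p` as a subspace. -/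
def V0Sub (p : ℕ) : Submodule ℝ (Plane → ℝ) where
  carrier := M.V0 p
  zero_mem' := ⟨(M.VSub p).zero_mem, fun _ _ => rfl⟩
  add_mem' := fun hv hw =>
    ⟨(M.VSub p).add_mem hv.1 hw.1, fun z hz => by simp [hv.2 z hz, hw.2 z hz]⟩
  smul_mem' := fun c v hv => ⟨(M.VSub p).smul_mem c hv.1, fun z hz => by simp [hv.2 z hz]⟩

/-- `[V_h^p]³` as a subspace. -/
def VVecSub (p : ℕ) : Submodule ℝ (Plane → Space) where
  carrier := M.VVec p
  zero_mem' := fun _ => (M.VSub p).zero_mem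
  add_mem' := fun hv hw i => (M.VSub p).add_mem (hv i) (hw i)
  smul_mem' := fun c _ hv i => (M.VSub p).smul_mem c (hv i)

/-- `[V_{h,0}^p]³` as a subspace. -/
def V0VecSub (p : ℕ) : Submodule ℝ (Plane → Space) where
  carrier := M.V0Vec p
  zero_mem' := fun _ => (M.V0Sub p).zero_mem
  add_mem' := fun hv hw i => (M.V0Sub p).add_mem (hv i) (hw i)
  smul_mem' := fun c _ hv i => (M.V0Sub p).smul_mem c (hv i)

variable {M} {p : ℕ}

theorem V0Vec_subset : M.V0Vec p ⊆ M.VVec p := fun _ hv i => (hv i).1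

theorem VVec_continuousOn {v : Plane → Space} (hv : v ∈ M.VVec p) : ContinuousOn v M.domain := by
  have h : ContinuousOn (fun x => WithLp.toLp 2 fun i => v x i) M.domain :=
    (PiLp.continuous_toLp 2 _).comp_continuousOn (continuousOn_pi.2 fun i => (hv i).1)
  exact h

theorem V_eq_sum_shape (hp : p = 1 ∨ p = 2) {v : Plane → ℝ} (hv : v ∈ M.V p)
    {K : Affine.Triangle ℝ Plane} (hK : K ∈ M.cells) {x : Plane} (hx : x ∈ refTriangle) :
    v (M.map K x) = ∑ n, shape p n x * v (M.map K (refNode n)) := by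
  obtain ⟨q, hq, hq'⟩ := hv.2.2 K hK
  rw [hq' x hx, eval_eq_sum_shape hp hq]
  exact Finset.sum_congr rfl fun n _ => by rw [hq' _ (refNode_mem n)]

/-- Nodal values embed the spaces into finitely many coordinates, which yields finite dimension. -/
theorem V_eq_zero_of_nodes (hp : p = 1 ∨ p = 2) {v : Plane → ℝ} (hv : v ∈ M.V p)
    (h : ∀ K ∈ M.cells, ∀ n, v (M.map K (refNode n)) = 0) : v = 0 := by
  funext z
  by_cases hz : z ∈ M.domain
  · obtain ⟨K, hK, x, hx, rfl⟩ := M.exists_of_mem_domain hz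
    rw [V_eq_sum_shape hp hv hK hx]
    simp [h K hK]
  · exact hv.2.1 z hz

theorem finiteDimensional_V0Sub (hp : p = 1 ∨ p = 2) : FiniteDimensional ℝ (M.V0Sub p) := by
  let e : M.V0Sub p →ₗ[ℝ] (M.cells × (Fin 3 ⊕ Fin 3) → ℝ) :=
    { toFun := fun v y => v.1 (M.map y.1 (refNode y.2))
      map_add' := fun _ _ => rfl
      map_smul' := fun _ _ => rfl }
  refine FiniteDimensional.of_injective e ((injective_iff_map_eq_zero e).2 fun v hv => ?_)
  exact Subtype.ext (V_eq_zero_of_nodes hp v.2.1 fun K hK n => congrFun hv (⟨K, hK⟩, n))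

theorem finiteDimensional_V0VecSub (hp : p = 1 ∨ p = 2) :
    FiniteDimensional ℝ (M.V0VecSub p) := by
  let e : M.V0VecSub p →ₗ[ℝ] (M.cells × (Fin 3 ⊕ Fin 3) → Space) :=
    { toFun := fun v y => v.1 (M.map y.1 (refNode y.2))
      map_add' := fun _ _ => rfl
      map_smul' := fun _ _ => rfl }
  refine FiniteDimensional.of_injective e ((injective_iff_map_eq_zero e).2 fun v hv => ?_)
  refine Subtype.ext (funext fun z => ?_)
  ext i
  exact congrFun (V_eq_zero_of_nodes hp (v.2 i).1 fun K hK n => by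
    have := congrFun hv (⟨K, hK⟩, n)
    exact congrArg (fun s : Space => s i) this) z

/-! ### The forms `l2Inner` and `b` -/

section L2

variable {F : Type*} [NormedAddCommGroup F] [InnerProductSpace ℝ F]

theorem integrableOn_of_continuousOn {f : Plane → ℝ} (hf : ContinuousOn f M.domain) :
    IntegrableOn f M.domain := hf.integrableOn_compact M.isCompact_domain

theorem l2Inner_comm (v w : Plane → F) : M.l2Inner v w = M.l2Inner w v :=
  integral_congr_ae (ae_of_all _ fun _ => real_inner_comm _ _)

theorem l2Inner_add_left {u v w : Plane → F} (hu : ContinuousOn u M.domain)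
    (hv : ContinuousOn v M.domain) (hw : ContinuousOn w M.domain) :
    M.l2Inner (u + v) w = M.l2Inner u w + M.l2Inner v w := by
  simp only [l2Inner, Pi.add_apply, inner_add_left]
  exact integral_add (integrableOn_of_continuousOn (hu.inner hw))
    (integrableOn_of_continuousOn (hv.inner hw))

theorem l2Inner_smul_left (c : ℝ) (v w : Plane → F) :
    M.l2Inner (c • v) w = c * M.l2Inner v w := by
  simp only [l2Inner, Pi.smul_apply, real_inner_smul_left]
  exact integral_const_mul _ _

theorem l2Inner_self_nonneg (v : Plane → F) : 0 ≤ M.l2Inner v v :=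
  integral_nonneg fun _ => real_inner_self_nonneg

end L2

variable {a : Plane → Space}

theorem b_add_left (ha : ContinuousOn a M.domain) {u v : Plane → Space} {w : Plane → ℝ}
    (hu : ContinuousOn u M.domain) (hv : ContinuousOn v M.domain) (hw : ContinuousOn w M.domain) :
    M.b a (u + v) w = M.b a u w + M.b a v w := by
  simp only [b, Pi.add_apply, inner_add_right]
  exact l2Inner_add_left (ha.inner hu) (ha.inner hv) hw

theorem b_smul_left (c : ℝ) (v : Plane → Space) (w : Plane → ℝ) :
    M.b a (c • v) w = c * M.b a v w := by
  simp only [b, Pi.smul_apply, real_inner_smul_right]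
  exact l2Inner_smul_left c _ w

theorem b_add_right (ha : ContinuousOn a M.domain) {v : Plane → Space} {w z : Plane → ℝ}
    (hv : ContinuousOn v M.domain) (hw : ContinuousOn w M.domain) (hz : ContinuousOn z M.domain) :
    M.b a v (w + z) = M.b a v w + M.b a v z := by
  simp only [b]
  rw [l2Inner_comm, l2Inner_add_left hw hz (ha.inner hv), l2Inner_comm, l2Inner_comm z]

theorem b_smul_right (c : ℝ) (v : Plane → Space) (w : Plane → ℝ) :
    M.b a v (c • w) = c * M.b a v w := by
  simp only [b]
  rw [l2Inner_comm, l2Inner_smul_left, l2Inner_comm]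

/-! ### Gradients of finite element functions -/

/-- A function that is `C¹` in the reference variable is differentiable inside the elements, with
bounded derivative. -/
theorem exists_fderiv_bound (hM : M.IsRegular) {F : Type*} [NormedAddCommGroup F]
    [NormedSpace ℝ F] {v Q : Plane → F} {K : Affine.Triangle ℝ Plane} (hK : K ∈ M.cells)
    (hQ : ContDiff ℝ 1 Q) (h : ∀ x ∈ refTriangle, v (M.map K x) = Q x) :
    ∃ C, ∀ x ∈ openTriangle, DifferentiableAt ℝ v (M.map K x) ∧ ‖fderiv ℝ v (M.map K x)‖ ≤ C := by
  obtain ⟨D, hD, hdet⟩ := hM K hK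
  have hne : ∀ x ∈ refTriangle, (M.mapDeriv K x).det ≠ 0 := fun x hx h0 => by
    have := (hdet x hx).1
    rw [h0, abs_zero] at this
    linarith
  -- The chain rule will bound the derivative of `v` by this product, which is continuous up to the
  -- boundary of the reference triangle because the Jacobian does not vanish there.
  have hcont : ContinuousOn
      (fun x => ‖fderiv ℝ Q x‖ * ‖ContinuousLinearMap.inverse (M.mapDeriv K x)‖) refTriangle := by
    refine (hQ.continuous_fderiv one_ne_zero).norm.continuousOn.mul (ContinuousOn.norm fun x hx => ?_)
    have h1 : ContinuousAt (ContinuousLinearMap.inverse : (Plane →L[ℝ] Plane) → Plane →L[ℝ] Plane)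
        (M.mapDeriv K x) := by
      have := contDiffAt_map_inverse (𝕜 := ℝ) (n := 1)
        ((M.mapDeriv K x).toContinuousLinearEquivOfDetNeZero (hne x hx))
      rw [ContinuousLinearMap.coe_toContinuousLinearEquivOfDetNeZero] at this
      exact this.continuousAt
    exact (ContinuousAt.comp (f := M.mapDeriv K) (x := x) h1
      (M.continuous_mapDeriv K).continuousAt).continuousWithinAt
  obtain ⟨C, hC⟩ := (isCompact_refTriangle.image_of_continuousOn hcont).isBounded.exists_norm_le
  refine ⟨C, fun x hx => ?_⟩
  have hxr := openTriangle_subset hx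
  set e := (M.mapDeriv K x).toContinuousLinearEquivOfDetNeZero (hne x hxr) with he
  have hecoe : (e : Plane →L[ℝ] Plane) = M.mapDeriv K x :=
    ContinuousLinearMap.coe_toContinuousLinearEquivOfDetNeZero _ _
  have hs : HasStrictFDerivAt (M.map K) (e : Plane →L[ℝ] Plane) x := by
    rw [hecoe]; exact M.hasStrictFDerivAt_map K x
  have hinv := hs.to_localInverse
  have hx0 : hs.localInverse _ _ _ (M.map K x) = x := hs.localInverse_apply_image
  -- Near an interior image point the local inverse takes values in the open triangle, where the
  -- polynomial representation holds.
  have hvQ : v =ᶠ[𝓝 (M.map K x)] Q ∘ hs.localInverse _ _ _ := by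
    filter_upwards [hs.eventually_right_inverse,
      hs.localInverse_tendsto.eventually (isOpen_openTriangle.mem_nhds hx)] with y hy hyo
    rw [Function.comp_apply, ← h _ (openTriangle_subset hyo), hy]
  have hQx : HasFDerivAt Q (fderiv ℝ Q x) (hs.localInverse _ _ _ (M.map K x)) := by
    rw [hx0]; exact (hQ.differentiable one_ne_zero x).hasFDerivAt
  have hv : HasFDerivAt v ((fderiv ℝ Q x).comp (e.symm : Plane →L[ℝ] Plane)) (M.map K x) :=
    (hQx.comp _ hinv.hasFDerivAt).congr_of_eventuallyEq hvQ
  refine ⟨hv.differentiableAt, ?_⟩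
  rw [hv.fderiv]
  refine (ContinuousLinearMap.opNorm_comp_le _ _).trans ?_
  have := hC _ (mem_image_of_mem _ hxr)
  rw [← hecoe, ContinuousLinearMap.inverse_equiv] at this
  exact (le_abs_self _).trans this

theorem contDiff_eval (q : MvPolynomial (Fin 2) ℝ) :
    ContDiff ℝ 1 fun x : Plane => MvPolynomial.eval (fun i => x i) q := by
  simp only [MvPolynomial.eval_eq']
  refine ContDiff.sum fun d _ => contDiff_const.mul (contDiff_prod fun i _ => ContDiff.pow ?_ _)
  exact (EuclideanSpace.proj i : Plane →L[ℝ] ℝ).contDiff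

/-- Needed because `fderiv` is zero by default at points of non-differentiability: linearity of
`gradInner` requires differentiability almost everywhere, and integrability uses the bound. -/
theorem VVec_ae_differentiable (hM : M.IsRegular) {v : Plane → Space} (hv : v ∈ M.VVec p) :
    ∃ C, ∀ᵐ z ∂volume.restrict M.domain, DifferentiableAt ℝ v z ∧ ‖fderiv ℝ v z‖ ≤ C := by
  have h : ∀ K : M.cells, ∃ C, ∀ x ∈ openTriangle,
      DifferentiableAt ℝ v (M.map K x) ∧ ‖fderiv ℝ v (M.map K x)‖ ≤ C := by
    intro K
    choose q _ hq using fun i => (hv i).2.2 K K.2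
    refine exists_fderiv_bound hM K.2
      (Q := fun x => WithLp.toLp 2 fun i => MvPolynomial.eval (fun j => x j) (q i)) ?_ fun x hx => ?_
    · exact contDiff_euclidean.2 fun i => contDiff_eval (q i)
    · ext i
      exact hq i x hx
  choose C hC using h
  refine ⟨∑ K, |C K|, ?_⟩
  filter_upwards [M.ae_domain] with z hz
  obtain ⟨K, hK, x, hx, rfl⟩ := hz
  obtain ⟨h1, h2⟩ := hC ⟨K, hK⟩ x hx
  refine ⟨h1, h2.trans ((le_abs_self _).trans ?_)⟩
  exact Finset.single_le_sum (f := fun K => |C K|) (fun _ _ => abs_nonneg _) (Finset.mem_univ _)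

theorem integrableOn_grad (hM : M.IsRegular) {v w : Plane → Space} (hv : v ∈ M.VVec p)
    (hw : w ∈ M.VVec p) :
    IntegrableOn (fun x => ∑ i : Fin 2, inner ℝ (fderiv ℝ v x (EuclideanSpace.single i 1))
      (fderiv ℝ w x (EuclideanSpace.single i 1))) M.domain := by
  obtain ⟨C, hC⟩ := VVec_ae_differentiable hM hv
  obtain ⟨C', hC'⟩ := VVec_ae_differentiable hM hw
  refine integrable_finsetSum _ fun i _ => ?_
  have : IsFiniteMeasure (volume.restrict M.domain) :=
    ⟨by rw [Measure.restrict_apply_univ]; exact M.isCompact_domain.measure_lt_top⟩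
  refine Integrable.of_bound (C := C * C') ?_ ?_
  · exact ((measurable_fderiv_apply_const ℝ v _).aestronglyMeasurable).inner
      ((measurable_fderiv_apply_const ℝ w _).aestronglyMeasurable)
  · filter_upwards [hC, hC'] with z h1 h2
    refine (norm_inner_le_norm _ _).trans ?_
    have a1 : ‖fderiv ℝ v z (EuclideanSpace.single i 1)‖ ≤ C :=
      ((fderiv ℝ v z).le_opNorm _).trans (by simpa using h1.2)
    have a2 : ‖fderiv ℝ w z (EuclideanSpace.single i 1)‖ ≤ C' :=
      ((fderiv ℝ w z).le_opNorm _).trans (by simpa using h2.2)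
    exact mul_le_mul a1 a2 (norm_nonneg _) ((norm_nonneg _).trans a1)

theorem gradInner_comm (v w : Plane → Space) : M.gradInner v w = M.gradInner w v :=
  integral_congr_ae (ae_of_all _ fun _ => Finset.sum_congr rfl fun _ _ => real_inner_comm _ _)

theorem gradInner_add_left (hM : M.IsRegular) {u v w : Plane → Space} (hu : u ∈ M.VVec p)
    (hv : v ∈ M.VVec p) (hw : w ∈ M.VVec p) :
    M.gradInner (u + v) w = M.gradInner u w + M.gradInner v w := by
  obtain ⟨_, hC⟩ := VVec_ae_differentiable hM hu
  obtain ⟨_, hC'⟩ := VVec_ae_differentiable hM hv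
  unfold gradInner
  rw [← integral_add (integrableOn_grad hM hu hw) (integrableOn_grad hM hv hw)]
  refine integral_congr_ae ?_
  filter_upwards [hC, hC'] with z h1 h2
  rw [fderiv_add h1.1 h2.1]
  simp [inner_add_left]
  ring

theorem gradInner_smul_left (hM : M.IsRegular) (c : ℝ) {v w : Plane → Space} (hv : v ∈ M.VVec p) :
    M.gradInner (c • v) w = c * M.gradInner v w := by
  obtain ⟨_, hC⟩ := VVec_ae_differentiable hM hv
  unfold gradInner
  rw [← integral_const_mul]
  refine integral_congr_ae ?_
  filter_upwards [hC] with z h1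
  rw [fderiv_const_smul h1.1]
  simp [real_inner_smul_left]
  ring

theorem gradInner_self_nonneg (v : Plane → Space) : 0 ≤ M.gradInner v v :=
  integral_nonneg fun _ => Finset.sum_nonneg fun _ _ => real_inner_self_nonneg

/-! ### Norm equivalence on the elements -/

theorem continuousOn_map_comp {F : Type*} [TopologicalSpace F] {f : Plane → F}
    (hf : ContinuousOn f M.domain) {K : Affine.Triangle ℝ Plane} (hK : K ∈ M.cells) :
    ContinuousOn (fun x => f (M.map K x)) refTriangle :=
  hf.comp (M.continuous_map K).continuousOn fun _ hx => M.map_mem_domain hK hx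

theorem continuous_abs_det (K : Affine.Triangle ℝ Plane) :
    Continuous fun x => |(M.mapDeriv K x).det| :=
  (ContinuousLinearMap.continuous_det.comp (M.continuous_mapDeriv K)).abs

theorem integrableOn_det_mul {f : Plane → ℝ} (hf : ContinuousOn f M.domain)
    {K : Affine.Triangle ℝ Plane} (hK : K ∈ M.cells) :
    IntegrableOn (fun x => |(M.mapDeriv K x).det| * f (M.map K x)) openTriangle :=
  integrableOn_openTriangle ((continuous_abs_det K).continuousOn.mul (continuousOn_map_comp hf hK))

theorem volume_openTriangle_pos : 0 < volume.real openTriangle := by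
  refine ENNReal.toReal_pos (isOpen_openTriangle.measure_pos volume ⟨!₂[1 / 3, 1 / 3], ?_⟩).ne'
    volume_openTriangle_lt_top.ne
  refine ⟨?_, ?_, ?_⟩ <;> (simp; try norm_num)

theorem integral_det_pos (hM : M.IsRegular) {K : Affine.Triangle ℝ Plane} (hK : K ∈ M.cells) :
    0 < ∫ x in openTriangle, |(M.mapDeriv K x).det| := by
  obtain ⟨D, hD, h⟩ := hM K hK
  refine lt_of_lt_of_le (mul_pos volume_openTriangle_pos (half_pos hD)) ?_
  rw [← smul_eq_mul, ← setIntegral_const]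
  exact setIntegral_mono_on (integrableOn_const volume_openTriangle_lt_top.ne)
    (integrableOn_openTriangle (continuous_abs_det K).continuousOn) isOpen_openTriangle.measurableSet
    fun x hx => (h x (openTriangle_subset hx)).1

/-- On each element, the maximum of a finite element function is controlled by its `L²` norm. -/
theorem exists_sq_mul_le : ∃ C > (0 : ℝ), ∀ M : DiskMesh, M.IsRegular → ∀ p, p = 1 ∨ p = 2 →
    ∀ w ∈ M.V p, ∀ K ∈ M.cells, ∀ x ∈ refTriangle,
      w (M.map K x) ^ 2 * ∫ y in openTriangle, |(M.mapDeriv K y).det| ≤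
        C * ∫ y in openTriangle, |(M.mapDeriv K y).det| * w (M.map K y) ^ 2 := by
  obtain ⟨C, hC, h⟩ := exists_sq_le_integral
  have hvol := volume_openTriangle_pos
  -- The factor 3 is the ratio of the Jacobian bounds `3/2 D` and `D/2`; `D` itself cancels, so the
  -- constant does not depend on the mesh.
  refine ⟨3 * volume.real openTriangle * C, by positivity, fun M hM p hp w hw K hK x hx => ?_⟩
  obtain ⟨D, hD, hdet⟩ := hM K hK
  obtain ⟨q, hq, hq'⟩ := hw.2.2 K hK
  have hq2 : q.totalDegree ≤ 2 := hq.trans (by omega)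
  have h1 := h q hq2 x hx
  rw [← hq' x hx] at h1
  have hI : ∫ y in openTriangle, (MvPolynomial.eval (fun i => y i) q) ^ 2 =
      ∫ y in openTriangle, w (M.map K y) ^ 2 :=
    setIntegral_congr_fun isOpen_openTriangle.measurableSet fun y hy => by
      simp only [hq' y (openTriangle_subset hy)]
  rw [hI] at h1
  have hw2 : ContinuousOn (fun z => w z ^ 2) M.domain := hw.1.pow 2
  have h2 : ∫ y in openTriangle, |(M.mapDeriv K y).det| ≤
      volume.real openTriangle * (3 / 2 * D) := by
    rw [← smul_eq_mul, ← setIntegral_const]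
    exact setIntegral_mono_on (integrableOn_openTriangle (continuous_abs_det K).continuousOn)
      (integrableOn_const volume_openTriangle_lt_top.ne) isOpen_openTriangle.measurableSet
      fun y hy => (hdet y (openTriangle_subset hy)).2
  have h3 : D / 2 * ∫ y in openTriangle, w (M.map K y) ^ 2 ≤
      ∫ y in openTriangle, |(M.mapDeriv K y).det| * w (M.map K y) ^ 2 := by
    rw [← integral_const_mul]
    exact setIntegral_mono_on
      ((integrableOn_openTriangle (continuousOn_map_comp hw2 hK)).const_mul _)
      (integrableOn_det_mul hw2 hK) isOpen_openTriangle.measurableSet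
      fun y hy => mul_le_mul_of_nonneg_right (hdet y (openTriangle_subset hy)).1 (sq_nonneg _)
  set I := ∫ y in openTriangle, w (M.map K y) ^ 2
  calc w (M.map K x) ^ 2 * ∫ y in openTriangle, |(M.mapDeriv K y).det|
      ≤ (C * I) * (volume.real openTriangle * (3 / 2 * D)) :=
        mul_le_mul h1 h2 (integral_nonneg fun _ => abs_nonneg _) ((sq_nonneg _).trans h1)
    _ = 3 * volume.real openTriangle * C * (D / 2 * I) := by ring
    _ ≤ _ := by gcongr

theorem V_eq_zero_of_l2Inner_self (hM : M.IsRegular) (hp : p = 1 ∨ p = 2) {w : Plane → ℝ}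
    (hw : w ∈ M.V p) (h : M.l2Inner w w ≤ 0) : w = 0 := by
  obtain ⟨C, hC, hb⟩ := exists_sq_mul_le
  have hw2 : ContinuousOn (fun z => w z ^ 2) M.domain := hw.1.pow 2
  have hnn : ∀ K ∈ M.cells,
      0 ≤ ∫ y in openTriangle, |(M.mapDeriv K y).det| * w (M.map K y) ^ 2 := fun K _ =>
    integral_nonneg fun _ => mul_nonneg (abs_nonneg _) (sq_nonneg _)
  have hsum : ∑ K ∈ M.cells, ∫ y in openTriangle, |(M.mapDeriv K y).det| * w (M.map K y) ^ 2 = 0 := by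
    refine le_antisymm ?_ (Finset.sum_nonneg hnn)
    rw [← M.integral_domain (f := fun z => w z ^ 2) (integrableOn_of_continuousOn hw2)]
    refine le_of_eq_of_le (integral_congr_ae (ae_of_all _ fun z => ?_)) h
    simp [sq]
  funext z
  by_cases hz : z ∈ M.domain
  · obtain ⟨K, hK, x, hx, rfl⟩ := M.exists_of_mem_domain hz
    have h1 := hb M hM p hp w hw K hK x hx
    rw [(Finset.sum_eq_zero_iff_of_nonneg hnn).1 hsum K hK, mul_zero] at h1
    have h2 := integral_det_pos hM hK
    have h3 : w (M.map K x) ^ 2 ≤ 0 := nonpos_of_mul_nonpos_left h1 h2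
    exact pow_eq_zero_iff two_ne_zero |>.1 (le_antisymm h3 (sq_nonneg _))
  · exact hw.2.1 z hz

theorem VVec_eq_zero_of_l2Inner_self (hM : M.IsRegular) (hp : p = 1 ∨ p = 2) {v : Plane → Space}
    (hv : v ∈ M.VVec p) (h : M.l2Inner v v ≤ 0) : v = 0 := by
  have hi : ∀ i, (fun x => v x i) = 0 := fun i => by
    refine V_eq_zero_of_l2Inner_self hM hp (hv i) (le_trans ?_ h)
    refine integral_mono (integrableOn_of_continuousOn ((hv i).1.inner (hv i).1))
      (integrableOn_of_continuousOn ((VVec_continuousOn hv).inner (VVec_continuousOn hv)))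
      fun z => ?_
    simp only [real_inner_self_eq_norm_sq]
    exact pow_le_pow_left₀ (norm_nonneg _) (PiLp.norm_apply_le (v z) i) 2
  funext z
  ext i
  exact congrFun (hi i) z

end DiskMesh

namespace DiskMesh

/-! ### The discrete inf-sup condition -/

variable {M : DiskMesh} {p : ℕ}

/-- The interpolant of `g w` for a finite element function `w`. -/
theorem exists_interpolant_smul (hp : p = 1 ∨ p = 2) (g : Plane → Space) {w : Plane → ℝ}
    (hw : w ∈ M.V0 p) : ∃ v ∈ M.V0Vec p, ∀ K ∈ M.cells, ∀ x ∈ refTriangle,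
      v (M.map K x) = ∑ n, (shape p n x * w (M.map K (refNode n))) • g (M.map K (refNode n)) := by
  choose v hv hv' using fun i : Fin 3 => M.exists_interpolant hp fun z => g z i * w z
  refine ⟨fun z => WithLp.toLp 2 fun i => v i z, fun i => ⟨hv i, ?_⟩, fun K hK x hx => ?_⟩
  -- At a Lagrange node the shape functions single out the nodal value, which carries the factor `w
  -- = 0` on the boundary.
  · rintro z ⟨K, hK, x, hx, hxb, rfl⟩
    change v i (M.map K x) = 0
    rw [hv' i K hK x hx.1]
    obtain ⟨m, rfl, hm⟩ := exists_refNode_eq hp hx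
    simp only [hm, ite_mul, one_mul, zero_mul]
    refine (Finset.sum_ite_eq' _ _ _).trans ?_
    rw [if_pos (Finset.mem_univ _), hw.2 _ ⟨K, hK, _, hx, hxb, rfl⟩, mul_zero]
  · ext i
    change v i (M.map K x) = _
    rw [hv' i K hK x hx]
    simp only [WithLp.ofLp_sum, Finset.sum_apply, PiLp.smul_apply, smul_eq_mul]
    exact Finset.sum_congr rfl fun n _ => by ring

/-- Interpolation of `g w` changes `g w` only by the oscillation of `g`. -/
theorem norm_interpolant_sub_le (hp : p = 1 ∨ p = 2) {g v : Plane → Space} {w : Plane → ℝ}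
    (hw : w ∈ M.V p) {K : Affine.Triangle ℝ Plane} (hK : K ∈ M.cells) {x : Plane}
    (hx : x ∈ refTriangle) (hv : v (M.map K x) =
      ∑ n, (shape p n x * w (M.map K (refNode n))) • g (M.map K (refNode n)))
    {S η : ℝ} (hS : ∀ y ∈ refTriangle, |w (M.map K y)| ≤ S)
    (hg : ∀ y ∈ refTriangle, ‖g (M.map K y) - g (M.map K x)‖ ≤ η) :
    ‖v (M.map K x) - w (M.map K x) • g (M.map K x)‖ ≤ 6 * η * S := by
  -- Since `w` is its own interpolant, only differences of `g` remain, and no derivative of `g`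
  -- enters.
  have h : v (M.map K x) - w (M.map K x) • g (M.map K x) =
      ∑ n, (shape p n x * w (M.map K (refNode n))) •
        (g (M.map K (refNode n)) - g (M.map K x)) := by
    rw [hv, V_eq_sum_shape hp hw hK hx, Finset.sum_smul, ← Finset.sum_sub_distrib]
    simp only [smul_sub]
  rw [h]
  have hη : 0 ≤ η := (norm_nonneg _).trans (hg x hx)
  refine (norm_sum_le_of_le _ (n := fun _ => η * S) fun n _ => ?_).trans (by simp; linarith)
  have h1 := abs_shape_le_one p n hx
  have h2 := hS _ (refNode_mem n)
  have h3 := hg _ (refNode_mem n)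
  rw [norm_smul, norm_mul, Real.norm_eq_abs, Real.norm_eq_abs]
  have h4 : |shape p n x| * |w (M.map K (refNode n))| ≤ S := by
    nlinarith [abs_nonneg (w (M.map K (refNode n)))]
  calc _ ≤ S * η := mul_le_mul h4 h3 (norm_nonneg _) ((abs_nonneg _).trans h2)
    _ = η * S := mul_comm _ _

/-- The inf-sup condition holds with constant `1 / 2` if `a` is close to a unit vector field with
small oscillation on the elements. -/
theorem exists_infSup : ∃ η > (0 : ℝ), ∀ M : DiskMesh, M.IsRegular → ∀ p, p = 1 ∨ p = 2 →
    ∀ a g : Plane → Space, ContinuousOn a M.domain → (∀ z ∈ M.domain, ‖a z‖ = 1) →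
      (∀ z ∈ M.domain, ‖g z‖ = 1) → (∀ z ∈ M.domain, ‖a z - g z‖ ≤ 1 / 4) →
      (∀ K ∈ M.cells, ∀ x ∈ refTriangle, ∀ y ∈ refTriangle,
        ‖g (M.map K y) - g (M.map K x)‖ ≤ η) → InfSup M p a (1 / 2) := by
  obtain ⟨C, hC, hnorm⟩ := exists_sq_mul_le
  -- The second entry gives `6 η C ≤ 1/32`, which lowers `31/32` to `15/16`; the first absorbs the
  -- term quadratic in `η` in the bound for `‖v‖²`.
  refine ⟨min (1 / 192) (1 / (192 * C)), by positivity, ?_⟩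
  intro M hM p hp a g ha ha1 hg1 hag hosc w hw
  set η := min (1 / 192) (1 / (192 * C)) with hη
  have hη0 : 0 < η := by positivity
  have hη1 : η ≤ 1 / 192 := min_le_left _ _
  have hηC : 192 * (η * C) ≤ 1 := by
    have : η ≤ 1 / (192 * C) := min_le_right _ _
    rw [le_div_iff₀ (by positivity)] at this
    linarith
  obtain ⟨v, hv, hvint⟩ := exists_interpolant_smul hp g hw
  have hvc := VVec_continuousOn (V0Vec_subset hv)
  have hwc : ContinuousOn w M.domain := hw.1.1
  have hw2 : ContinuousOn (fun z => w z ^ 2) M.domain := hwc.pow 2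
  have hv2 : ContinuousOn (fun z => ‖v z‖ ^ 2) M.domain := hvc.norm.pow 2
  have hbc : ContinuousOn (fun z => inner ℝ (a z) (v z) * w z) M.domain := (ha.inner hvc).mul hwc
  have hWeq : M.l2Inner w w = ∫ z in M.domain, w z ^ 2 :=
    integral_congr_ae (ae_of_all _ fun z => by simp [sq])
  have hVeq : M.l2Inner v v = ∫ z in M.domain, ‖v z‖ ^ 2 :=
    integral_congr_ae (ae_of_all _ fun z => by simp)
  have hBeq : M.b a v w = ∫ z in M.domain, inner ℝ (a z) (v z) * w z :=
    integral_congr_ae (ae_of_all _ fun z => by simp [mul_comm])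
  have hcell : ∀ K ∈ M.cells,
      15 / 16 * (∫ x in openTriangle, |(M.mapDeriv K x).det| * w (M.map K x) ^ 2) ≤
        (∫ x in openTriangle, |(M.mapDeriv K x).det| *
          (inner ℝ (a (M.map K x)) (v (M.map K x)) * w (M.map K x))) ∧
      (∫ x in openTriangle, |(M.mapDeriv K x).det| * ‖v (M.map K x)‖ ^ 2) ≤
        2 * ∫ x in openTriangle, |(M.mapDeriv K x).det| * w (M.map K x) ^ 2 := by
    intro K hK
    set I := ∫ x in openTriangle, |(M.mapDeriv K x).det| * w (M.map K x) ^ 2 with hI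
    set m := ∫ x in openTriangle, |(M.mapDeriv K x).det| with hm
    have hm0 : 0 < m := integral_det_pos hM hK
    have hI0 : 0 ≤ I := integral_nonneg fun _ => mul_nonneg (abs_nonneg _) (sq_nonneg _)
    -- `S` bounds `|w|` on the element, and `S² m = C I`, so pointwise errors of size `η S²`
    -- integrate to `η C` times the squared weighted norm of `w`.
    set S := √(C * I / m) with hSdef
    have hS0 : 0 ≤ S := Real.sqrt_nonneg _
    have hS2 : S ^ 2 = C * I / m := Real.sq_sqrt (by positivity)
    have hSm : S ^ 2 * m = C * I := by rw [hS2]; field_simp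
    have hS : ∀ y ∈ refTriangle, |w (M.map K y)| ≤ S := fun y hy => by
      refine Real.abs_le_sqrt ?_
      rw [le_div_iff₀ hm0]
      exact hnorm M hM p hp w hw.1 K hK y hy
    have hpt : ∀ x ∈ openTriangle,
        31 / 32 * w (M.map K x) ^ 2 - 6 * η * S ^ 2 ≤
          inner ℝ (a (M.map K x)) (v (M.map K x)) * w (M.map K x) ∧
        ‖v (M.map K x)‖ ^ 2 ≤ w (M.map K x) ^ 2 + 18 * η * S ^ 2 := by
      intro x hx
      have hxr := openTriangle_subset hx
      have hxd := M.map_mem_domain hK hxr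
      have he := norm_interpolant_sub_le hp hw.1 hK hxr (hvint K hK x hxr) hS
        fun y hy => hosc K hK x hxr y hy
      have hwS := hS x hxr
      set z := M.map K x
      set e := v z - w z • g z with hedef
      have hve : v z = w z • g z + e := by rw [hedef]; abel
      have hw0 := abs_nonneg (w z)
      constructor
      -- For unit vectors `a · g = 1 - |a - g|²/2`, and `|a - g| ≤ 1/4`.
      · have h1 : inner ℝ (a z) (g z) ≥ 31 / 32 := by
          have h2 := norm_sub_sq_real (a z) (g z)
          rw [ha1 z hxd, hg1 z hxd] at h2
          have h3 := pow_le_pow_left₀ (norm_nonneg _) (hag z hxd) 2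
          linarith
        have h4 : |inner ℝ (a z) e| ≤ 6 * η * S := by
          refine (abs_real_inner_le_norm _ _).trans ?_
          rw [ha1 z hxd, one_mul]; exact he
        have h5 : |inner ℝ (a z) e * w z| ≤ 6 * η * S ^ 2 := by
          rw [abs_mul]
          calc _ ≤ 6 * η * S * S := mul_le_mul h4 hwS hw0 (by positivity)
            _ = _ := by ring
        rw [hve, inner_add_right, real_inner_smul_right]
        nlinarith [neg_abs_le (inner ℝ (a z) e * w z), sq_nonneg (w z)]
      · have h1 : ‖v z‖ ≤ |w z| + 6 * η * S := by
          rw [hve]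
          refine (norm_add_le _ _).trans (add_le_add ?_ he)
          rw [norm_smul, hg1 z hxd, mul_one, Real.norm_eq_abs]
        have h2 := pow_le_pow_left₀ (norm_nonneg _) h1 2
        have h3 : |w z| * (η * S) ≤ S * (η * S) := by gcongr
        have h4 : η * (η * S ^ 2) ≤ 1 / 192 * (η * S ^ 2) := by gcongr
        have h5 : 0 ≤ η * S ^ 2 := by positivity
        have h6 : (|w z| + 6 * η * S) ^ 2 =
            w z ^ 2 + 12 * (|w z| * (η * S)) + 36 * (η * (η * S ^ 2)) := by
          rw [← sq_abs (w z)]; ring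
        rw [h6] at h2
        nlinarith
    have hiw := integrableOn_det_mul hw2 hK
    have him : IntegrableOn (fun x => |(M.mapDeriv K x).det|) openTriangle :=
      integrableOn_openTriangle (continuous_abs_det K).continuousOn
    constructor
    · have h1 : 31 / 32 * I - 6 * η * S ^ 2 * m ≤ ∫ x in openTriangle, |(M.mapDeriv K x).det| *
          (inner ℝ (a (M.map K x)) (v (M.map K x)) * w (M.map K x)) := by
        rw [hI, hm, ← integral_const_mul, ← integral_const_mul,
          ← integral_sub (hiw.const_mul _) (him.const_mul _)]
        refine setIntegral_mono_on ((hiw.const_mul _).sub (him.const_mul _))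
          (integrableOn_det_mul hbc hK) isOpen_openTriangle.measurableSet fun x hx => ?_
        refine le_trans (le_of_eq ?_) (mul_le_mul_of_nonneg_left (hpt x hx).1 (abs_nonneg _))
        ring
      have h2 : 6 * η * S ^ 2 * m = 6 * (η * C) * I := by rw [mul_assoc, hSm]; ring
      nlinarith
    · have h1 : ∫ x in openTriangle, |(M.mapDeriv K x).det| * ‖v (M.map K x)‖ ^ 2 ≤
          I + 18 * η * S ^ 2 * m := by
        rw [hI, hm, ← integral_const_mul, ← integral_add hiw (him.const_mul _)]
        refine setIntegral_mono_on (integrableOn_det_mul hv2 hK)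
          (hiw.add (him.const_mul _)) isOpen_openTriangle.measurableSet fun x hx => ?_
        refine (mul_le_mul_of_nonneg_left (hpt x hx).2 (abs_nonneg _)).trans (le_of_eq ?_)
        ring
      have h2 : 18 * η * S ^ 2 * m = 18 * (η * C) * I := by rw [mul_assoc, hSm]; ring
      nlinarith
  have hB : 15 / 16 * M.l2Inner w w ≤ M.b a v w := by
    rw [hWeq, hBeq, M.integral_domain (integrableOn_of_continuousOn hw2),
      M.integral_domain (integrableOn_of_continuousOn hbc), Finset.mul_sum]
    exact Finset.sum_le_sum fun K hK => (hcell K hK).1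
  have hV : M.l2Inner v v ≤ 2 * M.l2Inner w w := by
    rw [hWeq, hVeq, M.integral_domain (integrableOn_of_continuousOn hw2),
      M.integral_domain (integrableOn_of_continuousOn hv2), Finset.mul_sum]
    exact Finset.sum_le_sum fun K hK => (hcell K hK).2
  -- Together with `hB` this gives `‖v‖² ≥ 7/8 ‖w‖²`, which excludes division by zero in the
  -- quotient.
  have hBV : M.b a v w ≤ (M.l2Inner v v + M.l2Inner w w) / 2 := by
    rw [hWeq, hVeq, hBeq, ← integral_add (integrableOn_of_continuousOn hv2)
      (integrableOn_of_continuousOn hw2), ← integral_div]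
    refine setIntegral_mono_on (integrableOn_of_continuousOn hbc)
      (((integrableOn_of_continuousOn hv2).add (integrableOn_of_continuousOn hw2)).div_const 2)
      M.isCompact_domain.measurableSet fun z hz => ?_
    have h1 : |inner ℝ (a z) (v z)| ≤ ‖v z‖ := by
      refine (abs_real_inner_le_norm _ _).trans ?_
      rw [ha1 z hz, one_mul]
    have h2 := (le_abs_self (inner ℝ (a z) (v z) * w z)).trans (abs_mul _ _).le
    have h3 : |inner ℝ (a z) (v z)| * |w z| ≤ ‖v z‖ * |w z| := by gcongr
    rw [le_div_iff₀ two_pos, ← sq_abs (w z)]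
    nlinarith [sq_nonneg (‖v z‖ - |w z|)]
  refine le_iSup₂_of_le v hv (EReal.coe_le_coe_iff.2 ?_)
  have hW0 := l2Inner_self_nonneg (M := M) w
  unfold l2Norm
  rcases hW0.eq_or_lt with h0 | hpos
  · rw [← h0] at hB ⊢
    rw [Real.sqrt_zero, mul_zero]
    exact div_nonneg (by linarith) (Real.sqrt_nonneg _)
  · have hVpos : 0 < M.l2Inner v v := by linarith
    rw [le_div_iff₀ (Real.sqrt_pos.2 hVpos), mul_assoc, ← Real.sqrt_mul hW0]
    -- `√2 ≤ 3/2`, and then `1/2 · 3/2 ≤ 15/16` closes the estimate.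
    have h1 : √(M.l2Inner w w * M.l2Inner v v) ≤ 3 / 2 * M.l2Inner w w := by
      rw [Real.sqrt_le_left (by positivity)]
      nlinarith
    linarith

end DiskMesh

/-! ### The saddle point problem -/

theorem existsUnique_of_injective_form {X : Type*} [AddCommGroup X] [Module ℝ X]
    [FiniteDimensional ℝ X] (B : X →ₗ[ℝ] Module.Dual ℝ X) (hB : ∀ x, B x = 0 → x = 0)
    (f : Module.Dual ℝ X) : ∃! x, B x = f := by
  have hinj : Function.Injective B := (injective_iff_map_eq_zero B).2 hB
  have hsurj := (LinearMap.injective_iff_surjective_of_finrank_eq_finrank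
    (Subspace.dual_finrank_eq (K := ℝ) (V := X)).symm).1 hinj
  exact ⟨_, (hsurj f).choose_spec, fun y hy => hinj (hy.trans (hsurj f).choose_spec.symm)⟩

namespace DiskMesh

variable {M : DiskMesh} {p : ℕ}

theorem InfSup.eq_zero {β : ℝ} (hβ : 0 < β) (hM : M.IsRegular) (hp : p = 1 ∨ p = 2)
    {a : Plane → Space} (h : InfSup M p a β) {w : Plane → ℝ} (hw : w ∈ M.V0 p)
    (h0 : ∀ v ∈ M.V0Vec p, M.b a v w = 0) : w = 0 := by
  have h1 := h w hw
  have h2 : (⨆ v ∈ M.V0Vec p, ((M.b a v w / M.l2Norm v : ℝ) : EReal)) ≤ ((0 : ℝ) : EReal) :=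
    iSup₂_le fun v hv => by rw [h0 v hv, zero_div]
  have h3 : β * M.l2Norm w ≤ 0 := EReal.coe_le_coe_iff.1 (h1.trans h2)
  have h4 : M.l2Norm w ≤ 0 := nonpos_of_mul_nonpos_right h3 hβ
  exact V_eq_zero_of_l2Inner_self hM hp hw.1 (Real.sqrt_eq_zero'.1 (le_antisymm h4 (Real.sqrt_nonneg _)))

/-- The saddle point problem with an arbitrary right-hand side is uniquely solvable under the
inf-sup condition. -/
theorem existsUnique_saddle (hM : M.IsRegular) (hp : p = 1 ∨ p = 2) {a : Plane → Space}
    (ha : ContinuousOn a M.domain) {β : ℝ} (hβ : 0 < β) (h : InfSup M p a β) {c : ℝ} (hc : 0 ≤ c)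
    (f : M.V0VecSub p →ₗ[ℝ] ℝ) :
    ∃! s : (Plane → Space) × (Plane → ℝ), s.1 ∈ M.V0Vec p ∧ s.2 ∈ M.V0 p ∧
      (∀ v, (hv : v ∈ M.V0Vec p) →
        M.l2Inner s.1 v + c * M.gradInner s.1 v + M.b a v s.2 = f ⟨v, hv⟩) ∧
      ∀ w ∈ M.V0 p, M.b a s.1 w = 0 := by
  have := finiteDimensional_V0Sub (M := M) hp
  have := finiteDimensional_V0VecSub (M := M) hp
  let X := M.V0VecSub p × M.V0Sub p
  -- Both equations are merged into one symmetric form on the product space; symmetry transfers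
  -- linearity from the first argument to the second.
  let form : X → X → ℝ := fun s t =>
    M.l2Inner s.1.1 t.1.1 + c * M.gradInner s.1.1 t.1.1 + M.b a t.1.1 s.2.1 + M.b a s.1.1 t.2.1
  have hVc : ∀ v : M.V0VecSub p, ContinuousOn v.1 M.domain := fun v =>
    VVec_continuousOn (V0Vec_subset v.2)
  have hV : ∀ v : M.V0VecSub p, v.1 ∈ M.VVec p := fun v => V0Vec_subset v.2
  have hw : ∀ w : M.V0Sub p, ContinuousOn w.1 M.domain := fun w => w.2.1.1
  have hsymm : ∀ s t, form s t = form t s := fun s t => by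
    simp only [form]
    rw [l2Inner_comm, gradInner_comm]
    ring
  have hadd : ∀ s s' t, form (s + s') t = form s t + form s' t := fun s s' t => by
    simp only [form]
    have e1 : (s + s').1.1 = s.1.1 + s'.1.1 := rfl
    have e2 : (s + s').2.1 = s.2.1 + s'.2.1 := rfl
    rw [e1, e2, l2Inner_add_left (hVc _) (hVc _) (hVc _),
      gradInner_add_left hM (hV _) (hV _) (hV _), b_add_right ha (hVc _) (hw _) (hw _),
      b_add_left ha (hVc _) (hVc _) (hw _)]
    ring
  have hsmul : ∀ (r : ℝ) s t, form (r • s) t = r * form s t := fun r s t => by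
    simp only [form]
    have e1 : (r • s).1.1 = r • s.1.1 := rfl
    have e2 : (r • s).2.1 = r • s.2.1 := rfl
    rw [e1, e2, l2Inner_smul_left, gradInner_smul_left hM r (hV _), b_smul_left, b_smul_right]
    ring
  let B : X →ₗ[ℝ] Module.Dual ℝ X := LinearMap.mk₂ ℝ form hadd hsmul
    (fun s t t' => by rw [hsymm, hadd, hsymm t, hsymm t'])
    (fun r s t => by rw [hsymm, hsmul, hsymm t]; rfl)
  have hB : ∀ s, B s = 0 → s = 0 := by
    intro s hs
    have hs' : ∀ t, form s t = 0 := fun t => LinearMap.congr_fun hs t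
    have hz : ∀ w : M.V0Sub p, M.b a s.1.1 w.1 = 0 := fun w => by
      have := hs' (0, w)
      -- Zero is written as a zero multiple so that homogeneity of the forms removes its terms.
      have e : ((0 : M.V0VecSub p) : Plane → Space) = (0 : ℝ) • s.1.1 := by simp
      simp only [form] at this
      rw [e, l2Inner_comm, gradInner_comm, l2Inner_smul_left,
        gradInner_smul_left hM 0 (hV _), b_smul_left] at this
      linarith
    -- Testing with `s` itself, the coupling terms vanish by `hz`, which leaves `‖u‖² + c ‖∇u‖² =
    -- 0`.
    have h1 : s.1 = 0 := by
      refine Subtype.ext (VVec_eq_zero_of_l2Inner_self hM hp (hV s.1) ?_)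
      have := hs' s
      simp only [form] at this
      rw [hz s.2] at this
      have := mul_nonneg hc (gradInner_self_nonneg (M := M) s.1.1)
      linarith
    -- With the primal part gone, the multiplier is annihilated by every test function, and inf-sup
    -- applies.
    have h2 : s.2 = 0 := by
      refine Subtype.ext (InfSup.eq_zero hβ hM hp h s.2.2 fun v hv => ?_)
      have := hs' (⟨v, hv⟩, s.2)
      simp only [form] at this
      have e : (s.1 : Plane → Space) = (0 : ℝ) • v := by rw [h1]; simp
      rw [e, l2Inner_smul_left, gradInner_smul_left hM 0 (V0Vec_subset hv), b_smul_left] at this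
      linarith
    exact Prod.ext h1 h2
  obtain ⟨s, hs, huniq⟩ := existsUnique_of_injective_form B hB (f.comp (LinearMap.fst ℝ _ _))
  have hs' : ∀ t, form s t = f t.1 := fun t => LinearMap.congr_fun hs t
  refine ⟨(s.1.1, s.2.1), ⟨s.1.2, s.2.2, fun v hv => ?_, fun w hw => ?_⟩, ?_⟩
  · have := hs' (⟨v, hv⟩, 0)
    simp only [form] at this
    have e : ((0 : M.V0Sub p) : Plane → ℝ) = (0 : ℝ) • s.2.1 := by simp
    rw [e, b_smul_right] at this
    linarith
  · have := hs' (0, ⟨w, hw⟩)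
    simp only [form, map_zero] at this
    have e : ((0 : M.V0VecSub p) : Plane → Space) = (0 : ℝ) • s.1.1 := by simp
    rw [e, l2Inner_comm, gradInner_comm, l2Inner_smul_left,
      gradInner_smul_left hM 0 (hV _), b_smul_left] at this
    linarith
  · rintro ⟨u, l⟩ ⟨hu, hl, h1, h2⟩
    have := huniq (⟨u, hu⟩, ⟨l, hl⟩) (LinearMap.ext fun t => by
      change form _ t = f t.1
      simp only [form]
      rw [h1 t.1.1 t.1.2, h2 t.2.1 t.2.2, add_zero])
    rw [← this]

end DiskMesh

/-! ### The iterates of the tangential finite element method -/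

/-- Order 2 occurs only for `j ≥ 1`, so the natural subtraction `j - 1` in the extrapolation is
never truncated. -/
theorem stepOrder_cases {k : ℕ} (hk : k = 1 ∨ k = 2) (j : ℕ) :
    stepOrder k j = 1 ∨ stepOrder k j = 2 ∧ 1 ≤ j := by
  unfold stepOrder; omega

theorem bdf_zero_pos {k : ℕ} (hk : k = 1 ∨ k = 2) (j : ℕ) : 0 < bdf (stepOrder k j) 0 := by
  rcases stepOrder_cases hk j with h | ⟨h, -⟩ <;> rw [h] <;> simp [bdf]

theorem IsTFEM.mem_VVec {M : DiskMesh} {p k J : ℕ} {τ : ℝ} {u₀ : Plane → Space}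
    {U : ℕ → Plane → Space} (h : IsTFEM M p k τ J u₀ U) : ∀ j ≤ J, U j ∈ M.VVec p := by
  intro j
  induction j using Nat.strong_induction_on with
  | _ j ih =>
    intro hj
    rcases j with _ | j
    · exact h.initial.1
    · obtain ⟨du, hdu, -, hstep⟩ := h.step j (by omega)
      have hU : U (j + 1) = (τ / bdf (stepOrder k j) 0) • du - ∑ i ∈ Finset.Icc 1 (stepOrder k j),
          (bdf (stepOrder k j) i / bdf (stepOrder k j) 0) • U (j + 1 - i) := by
        funext x
        rw [hstep x]
        simp
      rw [hU]
      refine (M.VVecSub p).sub_mem ((M.VVecSub p).smul_mem _ (DiskMesh.V0Vec_subset hdu.1))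
        ((M.VVecSub p).sum_mem fun i hi => (M.VVecSub p).smul_mem _ (ih _ ?_ ?_))
      · have := (Finset.mem_Icc.1 hi).1; omega
      · omega

/-- Normalization moves `y` by `|‖y‖ - 1| ≤ ‖y - g‖`, so it at most doubles the distance to the unit
vector `g`. -/
theorem normalize_close {F : Type*} [NormedAddCommGroup F] [NormedSpace ℝ F] {y g : F}
    (hg : ‖g‖ = 1) (h : ‖y - g‖ ≤ 1 / 8) :
    y ≠ 0 ∧ ‖‖y‖⁻¹ • y‖ = 1 ∧ ‖‖y‖⁻¹ • y - g‖ ≤ 1 / 4 := by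
  have h0 : y ≠ 0 := by
    rintro rfl
    rw [zero_sub, norm_neg, hg] at h
    norm_num at h
  have hy : ‖y‖ ≠ 0 := norm_ne_zero_iff.2 h0
  have h1 : ‖‖y‖⁻¹ • y - y‖ ≤ 1 / 8 := by
    have : ‖y‖⁻¹ • y - y = (‖y‖⁻¹ - 1) • y := by module
    rw [this, norm_smul, ← norm_norm y, ← norm_mul, norm_norm, sub_mul, inv_mul_cancel₀ hy, one_mul,
      norm_sub_rev]
    have h2 := abs_norm_sub_norm_le y g
    rw [hg] at h2
    exact h2.trans h
  refine ⟨h0, by rw [norm_smul, norm_inv, norm_norm, inv_mul_cancel₀ hy], ?_⟩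
  have : ‖y‖⁻¹ • y - g = (‖y‖⁻¹ • y - y) + (y - g) := by abel
  rw [this]
  exact (norm_add_le _ _).trans (by linarith)

/-- The right-hand side of a step as a linear functional. -/
theorem exists_stepRhs_linear {M : DiskMesh} (hM : M.IsRegular) {p κ j J : ℕ} (hj : j < J)
    {U : ℕ → Plane → Space} (hU : ∀ i ≤ J, U i ∈ M.VVec p) :
    ∃ f : M.V0VecSub p →ₗ[ℝ] ℝ, ∀ v, f v = stepRhs M κ U j v.1 := by
  have hmem : ∀ i ∈ Finset.Icc 1 κ, U (j + 1 - i) ∈ M.VVec p := fun i hi =>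
    hU _ (by have := (Finset.mem_Icc.1 hi).1; omega)
  refine ⟨{ toFun := fun v => stepRhs M κ U j v.1, map_add' := fun v w => ?_,
            map_smul' := fun c v => ?_ }, fun v => rfl⟩
  · simp only [stepRhs, Submodule.coe_add]
    rw [← Finset.sum_add_distrib]
    refine Finset.sum_congr rfl fun i hi => ?_
    rw [DiskMesh.gradInner_comm, DiskMesh.gradInner_add_left hM (DiskMesh.V0Vec_subset v.2)
      (DiskMesh.V0Vec_subset w.2) (hmem i hi), DiskMesh.gradInner_comm,
      DiskMesh.gradInner_comm (w : Plane → Space)]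
    ring
  · simp only [stepRhs, Submodule.coe_smul, RingHom.id_apply, smul_eq_mul, Finset.mul_sum]
    refine Finset.sum_congr rfl fun i hi => ?_
    rw [DiskMesh.gradInner_comm, DiskMesh.gradInner_smul_left hM c (DiskMesh.V0Vec_subset v.2),
      DiskMesh.gradInner_comm]
    ring

/-- A step with an extrapolation for which the inf-sup condition holds is well-posed. -/
theorem existsUnique_isSaddleSolution {M : DiskMesh} (hM : M.IsRegular) {p k j J : ℕ}
    (hp : p = 1 ∨ p = 2) (hk : k = 1 ∨ k = 2) (hj : j < J) {τ : ℝ} (hτ : 0 ≤ τ)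
    {U : ℕ → Plane → Space} (hU : ∀ i ≤ J, U i ∈ M.VVec p)
    (ha : ContinuousOn (uHat k U j) M.domain) {β : ℝ} (hβ : 0 < β)
    (h : InfSup M p (uHat k U j) β) : ∃! s, IsSaddleSolution M p k τ U j s := by
  obtain ⟨f, hf⟩ := exists_stepRhs_linear (κ := stepOrder k j) hM hj hU
  have := DiskMesh.existsUnique_saddle hM hp ha hβ h
    (div_nonneg hτ (bdf_zero_pos hk j).le : 0 ≤ τ / bdf (stepOrder k j) 0) f
  simp only [hf] at this
  exact this

end TFEM

end

/-! ### Choice of the thresholds and conclusion -/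

theorem lemma1 (T : ℝ) (hT : 0 < T)
    (u₀ : TFEM.Plane → TFEM.Space)
    (hu₀ : ContDiffOn ℝ 2 u₀ (Metric.closedBall 0 1))
    (hu₀_unit : ∀ x ∈ Metric.closedBall (0 : TFEM.Plane) 1, ‖u₀ x‖ = 1)
    (u : ℝ → TFEM.Plane → TFEM.Space) (hu : TFEM.IsSmoothHMHFSolution T u₀ u) :
    ∃ β : ℝ, 0 < β ∧
      -- polynomial degree, order of the time discretization
      ∀ p k : ℕ, (p = 1 ∨ p = 2) → (k = 1 ∨ k = 2) →
      -- a family of discretizations: meshes, numbers of time steps, and iterates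
      ∀ (ι : Type) (M : ι → TFEM.DiskMesh) (J : ι → ℕ)
        (U : ι → ℕ → TFEM.Plane → TFEM.Space) (σ : ℝ), 0 < σ →
        (∀ i, (M i).IsQuasiUniform σ) → (∀ i, (M i).iso = true → p = 2) → (∀ i, 1 ≤ J i) →
        (∀ i, TFEM.IsTFEM (M i) p k (T / J i) (J i) u₀ (U i)) →
        -- uniform convergence of the iterates
        (∀ ε : ℝ, 0 < ε → ε ≤ 1 → ∃ ε₁ > (0 : ℝ), ∃ ε₂ > (0 : ℝ), ∀ i,
          T / J i ≤ ε₁ → (M i).h ≤ ε₂ →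
          ∀ j ≤ J i, ∀ x ∈ (M i).domain, ‖U i j x - u (j * (T / J i)) x‖ ≤ ε) →
        -- conclusion
        ∃ τ₀ > (0 : ℝ), ∃ h₀ > (0 : ℝ), ∀ i, T / J i ≤ τ₀ → (M i).h ≤ h₀ → ∀ j < J i,
          TFEM.InfSup (M i) p (TFEM.uHat k (U i) j) β ∧
          ∃! s, TFEM.IsSaddleSolution (M i) p k (T / J i) (U i) j s := by
  obtain ⟨η, hη, hinfsup⟩ := TFEM.DiskMesh.exists_infSup
  refine ⟨1 / 2, by norm_num, ?_⟩
  intro p k hp hk ι M J U σ hσ hqu _ hJ htfem hconv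
  have hunit := hu.norm_eq_one hT hu₀_unit
  have huc := (isCompact_Icc.prod
    (isCompact_closedBall (0 : TFEM.Plane) 1)).uniformContinuousOn_of_continuous
    hu.contDiffOn.continuousOn
  -- One modulus of continuity in space-time serves two purposes: oscillation at most `η` on
  -- elements and change at most `1/16` over a time step.
  obtain ⟨δ, hδ, hmod⟩ := Metric.uniformContinuousOn_iff.1 huc (min η (1 / 16)) (by positivity)
  -- For BDF2 the error budget is `2/48 + 1/48 + 1/16 = 1/8`, the distance allowed in
  -- `normalize_close`.
  obtain ⟨ε₁, hε₁, ε₂, hε₂, hclose⟩ := hconv (1 / 48) (by norm_num) (by norm_num)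
  -- Element diameters are at most `3 h ≤ 3δ/4 < δ` and time steps at most `δ/2 < δ`; the bounds `1`
  -- and `1/(24 σ⁴)` ensure regular Jacobians.
  refine ⟨min ε₁ (δ / 2), by positivity, min (min ε₂ 1) (min (1 / (24 * σ ^ 4)) (δ / 4)),
    by positivity, fun i hτ hh j hj => ?_⟩
  have hτ1 : T / J i ≤ ε₁ := hτ.trans (min_le_left _ _)
  have hτ2 : T / J i ≤ δ / 2 := hτ.trans (min_le_right _ _)
  have hh1 : (M i).h ≤ ε₂ := hh.trans ((min_le_left _ _).trans (min_le_left _ _))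
  have hh2 : (M i).h ≤ 1 := hh.trans ((min_le_left _ _).trans (min_le_right _ _))
  have hh3 : (M i).h ≤ 1 / (24 * σ ^ 4) := hh.trans ((min_le_right _ _).trans (min_le_left _ _))
  have hh4 : (M i).h ≤ δ / 4 := hh.trans ((min_le_right _ _).trans (min_le_right _ _))
  have hreg := (hqu i).isRegular hσ hh2 hh3
  have hUV := (htfem i).mem_VVec
  have hUc : ∀ l ≤ J i, ContinuousOn (U i l) (M i).domain := fun l hl =>
    TFEM.DiskMesh.VVec_continuousOn (hUV l hl)
  have hJ0 : (0 : ℝ) < J i := by exact_mod_cast hJ i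
  have hτ0 : 0 < T / J i := div_pos hT hJ0
  have hball := (M i).domain_subset
  have htime : ∀ l ≤ J i, (l : ℝ) * (T / J i) ∈ Icc 0 T := fun l hl => by
    refine ⟨by positivity, ?_⟩
    have : (l : ℝ) ≤ J i := by exact_mod_cast hl
    calc (l : ℝ) * (T / J i) ≤ J i * (T / J i) := by gcongr
      _ = T := by field_simp
  set g : TFEM.Plane → TFEM.Space := u (j * (T / J i)) with hg
  have hg1 : ∀ z ∈ (M i).domain, ‖g z‖ = 1 := fun z hz => hunit _ (htime j hj.le) z (hball hz)
  obtain ⟨y, hyc, hyg, hyu⟩ : ∃ y : TFEM.Plane → TFEM.Space, ContinuousOn y (M i).domain ∧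
      (∀ z ∈ (M i).domain, ‖y z - g z‖ ≤ 1 / 8) ∧
      TFEM.uHat k (U i) j = fun z => ‖y z‖⁻¹ • y z := by
    have hcj := hclose i hτ1 hh1 j hj.le
    rcases TFEM.stepOrder_cases hk j with h | ⟨h, hj1⟩
    · refine ⟨U i j, hUc j hj.le, fun z hz => (hcj z hz).trans (by norm_num), ?_⟩
      funext z
      simp [TFEM.uHat, TFEM.extrapolation, h]
    · refine ⟨fun z => (2 : ℝ) • U i j z - U i (j - 1) z,
        ((hUc j hj.le).const_smul (2 : ℝ)).sub (hUc (j - 1) (by omega)), fun z hz => ?_, ?_⟩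
      · have h1 := hcj z hz
        have h2 := hclose i hτ1 hh1 (j - 1) (by omega) z hz
        have h3 : ‖g z - u (((j - 1 : ℕ) : ℝ) * (T / J i)) z‖ ≤ 1 / 16 := by
          rw [← dist_eq_norm]
          refine (hmod (j * (T / J i), z) ⟨htime j hj.le, hball hz⟩
            (((j - 1 : ℕ) : ℝ) * (T / J i), z) ⟨htime (j - 1) (by omega), hball hz⟩ ?_).le.trans
            (min_le_right _ _)
          rw [dist_prod_same_right, Real.dist_eq, Nat.cast_sub hj1]
          have : (j : ℝ) * (T / J i) - (j - (1 : ℕ)) * (T / J i) = T / J i := by push_cast; ring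
          rw [this, abs_of_pos hτ0]
          linarith
        -- Comparison is with `u(t_j)`, so the extrapolation error splits into two discretization
        -- errors and one increment of `u` over a time step.
        have h4 : (2 : ℝ) • U i j z - U i (j - 1) z - g z = (2 : ℝ) • (U i j z - g z) +
            ((g z - u (((j - 1 : ℕ) : ℝ) * (T / J i)) z) -
              (U i (j - 1) z - u (((j - 1 : ℕ) : ℝ) * (T / J i)) z)) := by module
        rw [h4]
        refine (norm_add_le _ _).trans ?_
        have h5 := norm_sub_le (g z - u (((j - 1 : ℕ) : ℝ) * (T / J i)) z)
          (U i (j - 1) z - u (((j - 1 : ℕ) : ℝ) * (T / J i)) z)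
        rw [norm_smul, Real.norm_of_nonneg zero_le_two]
        linarith
      · funext z
        simp [TFEM.uHat, TFEM.extrapolation, h]
  have hprop := fun z hz => TFEM.normalize_close (hg1 z hz) (hyg z hz)
  have hac : ContinuousOn (TFEM.uHat k (U i) j) (M i).domain := by
    rw [hyu]
    exact (hyc.norm.inv₀ fun z hz => norm_ne_zero_iff.2 (hprop z hz).1).smul hyc
  have hIS : TFEM.InfSup (M i) p (TFEM.uHat k (U i) j) (1 / 2) := by
    refine hinfsup (M i) hreg p hp _ g hac (fun z hz => ?_) hg1 (fun z hz => ?_) ?_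
    · rw [hyu]; exact (hprop z hz).2.1
    · rw [hyu]; exact (hprop z hz).2.2
    · intro K hK x hx y hy
      have hd := (M i).dist_map_le hK hh2 hy hx
      rw [← dist_eq_norm]
      refine (hmod (j * (T / J i), (M i).map K y)
        ⟨htime j hj.le, hball ((M i).map_mem_domain hK hy)⟩ (j * (T / J i), (M i).map K x)
        ⟨htime j hj.le, hball ((M i).map_mem_domain hK hx)⟩ ?_).le.trans (min_le_left _ _)
      rw [dist_prod_same_left]
      linarith
  exact ⟨hIS, TFEM.existsUnique_isSaddleSolution hreg hp hk hj hτ0.le hUV hac (by norm_num) hIS⟩
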